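/- Let $a>b>c>0$ and let $$\mathbb{E}_{a,b,c}=\Big\{(x,y,z)\in\mathbb{R}^3:\ \frac{x^2}{a^2}+\frac{y^2}{b^2}+\frac{z^2}{c^2}=1\Big\}.$$ A harmonic mean curvature line of $\mathbb{E}_{a,b,c}$ is a regular curve $\gamma$ in the complement of the umbilic points, parametrized by arc length on an open interval and not extendable to a larger interval, whose normal curvature at every point is $k_n=\mathcal{K}/\mathcal{H}$, where $\mathcal{K}=k_1k_2$ and $\mathcal{H}=(k_1+k_2)/2$ are the Gaussian and the arithmetic mean curvature. It is an umbilic separatrix if at one of its two ends it tends to an umbilic point. Its $\omega$- and $\alpha$-limit sets are the sets of accumulation points of $\gamma(t)$ as $t$ tends to the upper, respectively the lower, end of its interval of definition. It is closed if it is defined on all of $\mathbb{R}$ and is periodic. Put $$h(x)=(x+a^2)(x+b^2)(x+c^2),\qquad S_1=\int_{-b^2}^{-c^2}\frac{dv}{\sqrt{|h(v)|}},\qquad S_2=\int_{-a^2}^{-b^2}\frac{du}{\sqrt{|h(u)|}},\qquad \rho=\frac{S_2}{S_1}.$$ (i) If $\rho$ is irrational, then every harmonic mean curvature line is nontrivially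 recurrent: it is not closed, and it is contained in its $\omega$-limit set or in its $\alpha$-limit set; if it is not an umbilic separatrix, it is contained in both. (ii) If $\rho$ is rational, then every harmonic mean curvature line that is not an umbilic separatrix is closed, and no umbilic separatrix is closed. -/

import Mathlib

open Filter Topology Set
open scoped RealInnerProductSpace

noncomputable section

/-- Euclidean three-space. -/
abbrev E3 : Type := EuclideanSpace ℝ (Fin 3)

/-! ## Curvatures of a regular level surface of a function -/

/-- The unit normal field of the level surfaces of `F`. -/
def unitNormal (F : E3 → ℝ) (p : E3) : E3 := ‖gradient F p‖⁻¹ • gradient F p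

/-- The tangent plane at `p` to the level surface of `F` through `p`. -/
def tangentPlane (F : E3 → ℝ) (p : E3) : Submodule ℝ E3 := (ℝ ∙ unitNormal F p)ᗮ

/-- The shape operator `-dN` on the tangent plane. As `‖N‖ = 1`, the derivative `dN` already takes
tangent values; the orthogonal projection only adjusts the codomain. -/
def shapeOperator (F : E3 → ℝ) (p : E3) : tangentPlane F p →ₗ[ℝ] tangentPlane F p :=
  -(((tangentPlane F p).orthogonalProjectionOnto.comp
      ((fderiv ℝ (unitNormal F) p).comp (tangentPlane F p).subtypeL)) :
        tangentPlane F p →L[ℝ] tangentPlane F p).toLinearMap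

/-- The Gaussian curvature, i.e. the product of the principal curvatures. -/
def gaussCurvature (F : E3 → ℝ) (p : E3) : ℝ := LinearMap.det (shapeOperator F p)

/-- The arithmetic mean curvature, i.e. half the sum of the principal curvatures. -/
def meanCurvature (F : E3 → ℝ) (p : E3) : ℝ := LinearMap.trace ℝ _ (shapeOperator F p) / 2

/-- The normal curvature `II(w, w) / I(w, w)` at `p` in the direction of a tangent vector `w`. -/
def normalCurvature (F : E3 → ℝ) (p w : E3) : ℝ :=
  ⟪-(fderiv ℝ (unitNormal F) p w), w⟫ / ⟪w, w⟫

/-- The principal curvatures coincide at `p`. -/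
def IsUmbilicPt (F : E3 → ℝ) (p : E3) : Prop := meanCurvature F p ^ 2 - gaussCurvature F p = 0

/-! ## The ellipsoid and its harmonic mean curvature lines -/

/-- The quadratic form whose level set at height `1` is the ellipsoid with semi-axes `a, b, c`. -/
def ellipsoidForm (a b c : ℝ) (p : E3) : ℝ := p 0 ^ 2 / a ^ 2 + p 1 ^ 2 / b ^ 2 + p 2 ^ 2 / c ^ 2

/-- The ellipsoid with semi-axes `a, b, c`. -/
def ellipsoid (a b c : ℝ) : Set E3 := {p | ellipsoidForm a b c p = 1}

/-- The umbilic points of the ellipsoid. -/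
def umbilics (a b c : ℝ) : Set E3 := {p ∈ ellipsoid a b c | IsUmbilicPt (ellipsoidForm a b c) p}

/-- `γ`, restricted to the open interval `I`, is an arc of a harmonic mean curvature line of the
ellipsoid, parametrized by arc length: a regular curve outside the umbilic points, whose normal
curvature is the harmonic mean `K / H` of the principal curvatures. (The ellipsoid has positive
Gaussian curvature, so that it has no parabolic points.) -/
structure IsHarmonicArc (a b c : ℝ) (I : Set ℝ) (γ : ℝ → E3) : Prop where
  isOpen : IsOpen I
  ordConnected : I.OrdConnected
  nonempty : I.Nonempty
  contDiffOn : ContDiffOn ℝ 1 γ I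
  mem : ∀ t ∈ I, γ t ∈ ellipsoid a b c \ umbilics a b c
  speed : ∀ t ∈ I, ‖deriv γ t‖ = 1
  harmonic : ∀ t ∈ I, normalCurvature (ellipsoidForm a b c) (γ t) (deriv γ t) =
    gaussCurvature (ellipsoidForm a b c) (γ t) / meanCurvature (ellipsoidForm a b c) (γ t)

/-- A harmonic mean curvature line (a leaf of one of the two harmonic mean curvature foliations):
an arc of such a line that cannot be extended to a larger interval. -/
structure IsHarmonicLine (a b c : ℝ) (I : Set ℝ) (γ : ℝ → E3) : Prop extends
    IsHarmonicArc a b c I γ where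
  maximal : ∀ (J : Set ℝ) (δ : ℝ → E3), IsHarmonicArc a b c J δ → I ⊆ J → EqOn γ δ I → J = I

/-- The line is a closed (periodic) curve. -/
def IsClosedLine (I : Set ℝ) (γ : ℝ → E3) : Prop :=
  I = univ ∧ ∃ T : ℝ, 0 < T ∧ Function.Periodic γ T

/-- The `ω`-limit set: accumulation points of `γ t` as `t` in `I` tends to the upper end of `I`. -/
def omegaLim (I : Set ℝ) (γ : ℝ → E3) : Set E3 :=
  {p | MapClusterPt p (atTop : Filter I) (fun t : I => γ t)}

/-- The `α`-limit set: accumulation points of `γ t` as `t` in `I` tends to the lower end of `I`. -/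
def alphaLim (I : Set ℝ) (γ : ℝ → E3) : Set E3 :=
  {p | MapClusterPt p (atBot : Filter I) (fun t : I => γ t)}

/-- The line lies in its `ω`-limit set. -/
def IsOmegaRecurrent (I : Set ℝ) (γ : ℝ → E3) : Prop := γ '' I ⊆ omegaLim I γ

/-- The line lies in its `α`-limit set. -/
def IsAlphaRecurrent (I : Set ℝ) (γ : ℝ → E3) : Prop := γ '' I ⊆ alphaLim I γ

/-- An umbilic separatrix: at one of its ends the line tends to an umbilic point. -/
def IsUmbilicSeparatrix (a b c : ℝ) (I : Set ℝ) (γ : ℝ → E3) : Prop :=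
  ∃ p ∈ umbilics a b c, Tendsto (fun t : I => γ t) atTop (𝓝 p) ∨
    Tendsto (fun t : I => γ t) atBot (𝓝 p)

/-! ## The elliptic integrals -/

/-- The cubic polynomial `(x + a²)(x + b²)(x + c²)`. -/
def hPoly (a b c x : ℝ) : ℝ := (x + a ^ 2) * (x + b ^ 2) * (x + c ^ 2)

/-- The elliptic integral over `[-b², -c²]`, where `hPoly` is negative. -/
def S₁ (a b c : ℝ) : ℝ := ∫ x in (-b ^ 2)..(-c ^ 2), 1 / √|hPoly a b c x|

/-- The elliptic integral over `[-a², -b²]`, where `hPoly` is positive. -/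
def S₂ (a b c : ℝ) : ℝ := ∫ x in (-a ^ 2)..(-b ^ 2), 1 / √|hPoly a b c x|

/-- The ratio `S₂ / S₁`. -/
def rho (a b c : ℝ) : ℝ := S₂ a b c / S₁ a b c

end

/-! The ellipsoid is covered by a plane with coordinates `u`, `v` built from Jacobi elliptic
functions, in which the coordinate curves are lines of curvature and the second fundamental form is
a multiple of `du² + dv²` (`form_tangent₁`, `form_tangent₂`, `inner_ellipsoidOp_tangent₁_tangent₂`).
A direction has normal curvature `K / H` exactly when the two principal components contribute
equally to the second fundamental form, hence exactly when `du = ± dv`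
(`normalCurvature_confocal_iff`). Harmonic mean curvature lines are therefore images of straight
lines of slope `±1`, cut at the umbilic points and parametrized by arc length
(`exists_eqOn_diagonalLine`).

Two points of the plane have the same image only if they agree up to the sign of `(u, v)` and the
lattice of periods four times `quarterPeriod n m` and `quarterPeriod m n` (`eq_of_confocalMap_eq`).
So the ellipsoid is a torus modulo `x ↦ -x`, and the umbilic points are the fixed points of this
involution, that is, the half-periods. The substitution `x = -b² + r sin² θ` identifies the ratio of
the two periods with `rho` (`rho_eq`).

What remains is the behaviour of slope `±1` lines on a torus. Dirichlet approximation brings every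
such line back near each of its points in both directions (`exists_diagonal_return`), as long as no
umbilic point stops it. For an irrational ratio a line meets at most one half-period
(`subsingleton_umbilic_times`), so at least one direction is unobstructed; a closed line would need
a period vector along the diagonal, or else a reflection whose midpoint is umbilic
(`not_isClosedLine_of_irrational`). For a rational ratio there is a diagonal period, and every
unobstructed line closes up (`isClosedLine_of_rational`). A line that does not exist for all time
stops at an umbilic point (`eq_univ_of_not_isUmbilicSeparatrix`). -/

section Primitives

/-- The primitive of a continuous function with positive integrals and of infinite total mass on
both sides is an order isomorphism of the line. -/
theorem exists_orderIso_primitive {f : ℝ → ℝ} (hf : Continuous f)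
    (hpos : ∀ x y, x < y → 0 < ∫ s in x..y, f s)
    (htop : Tendsto (fun s => ∫ x in (0 : ℝ)..s, f x) atTop atTop)
    (hbot : Tendsto (fun s => ∫ x in (0 : ℝ)..s, f x) atBot atBot) :
    ∃ e : ℝ ≃o ℝ, ∀ s, e s = ∫ x in (0 : ℝ)..s, f x := by
  have hmono : StrictMono (fun s => ∫ x in (0 : ℝ)..s, f x) := by
    intro x y hxy
    have h := intervalIntegral.integral_add_adjacent_intervals
      (hf.intervalIntegrable (μ := MeasureTheory.volume) 0 x)
      (hf.intervalIntegrable (μ := MeasureTheory.volume) x y)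
    have := hpos x y hxy
    simp only
    linarith
  have hcont : Continuous (fun s => ∫ x in (0 : ℝ)..s, f x) :=
    intervalIntegral.continuous_primitive (fun _ _ => hf.intervalIntegrable _ _) 0
  exact ⟨hmono.orderIsoOfSurjective _ (hcont.surjective htop hbot), fun s => rfl⟩

/-- Nonvanishing is required only at the one point: the integrand will be a speed that vanishes at
umbilic points, where the inverse of arc length is continuous but not differentiable. -/
theorem OrderIso.hasDerivAt_symm_of_primitive {f : ℝ → ℝ} (hf : Continuous f) (e : ℝ ≃o ℝ)
    (he : ∀ s, e s = ∫ x in (0 : ℝ)..s, f x) {t : ℝ} (ht : f (e.symm t) ≠ 0) :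
    HasDerivAt e.symm (f (e.symm t))⁻¹ t := by
  have h1 : HasDerivAt e (f (e.symm t)) (e.symm t) := by
    have := intervalIntegral.integral_hasDerivAt_right (hf.intervalIntegrable 0 (e.symm t))
      (hf.stronglyMeasurableAtFilter _ _) hf.continuousAt
    exact this.congr_of_eventuallyEq (Eventually.of_forall he)
  exact h1.of_local_left_inverse e.symm.continuous.continuousAt ht
    (Eventually.of_forall e.apply_symm_apply)

end Primitives

noncomputable section

/-! ## Jacobi elliptic functions -/

/-- `√(k + l sin² x)`. -/
def deltaAmp (k l x : ℝ) : ℝ := √(k + l * Real.sin x ^ 2)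

/-- The incomplete elliptic integral of the first kind. -/
def ellipticF (k l θ : ℝ) : ℝ := ∫ x in (0 : ℝ)..θ, 1 / deltaAmp k l x

/-- The Jacobi amplitude, the inverse of `ellipticF`. -/
def amplitude (k l : ℝ) : ℝ → ℝ := Function.invFun (ellipticF k l)

/-- The complete elliptic integral. -/
def quarterPeriod (k l : ℝ) : ℝ := ellipticF k l (Real.pi / 2)

/-- Variants of sn, cn, dn with `k + l sin²` under the root. With this sign convention the two
confocal coordinates use the same functions with `k` and `l` exchanged. -/
def sinAm (k l u : ℝ) : ℝ := Real.sin (amplitude k l u)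
def cosAm (k l u : ℝ) : ℝ := Real.cos (amplitude k l u)
def deltaAm (k l u : ℝ) : ℝ := deltaAmp k l (amplitude k l u)

section Elliptic

variable {k l : ℝ} (hk : 0 < k) (hl : 0 < l)
include hk hl

theorem deltaAmp_pos (x : ℝ) : 0 < deltaAmp k l x := Real.sqrt_pos.2 (by positivity)

theorem deltaAmp_sq (x : ℝ) : deltaAmp k l x ^ 2 = k + l * Real.sin x ^ 2 :=
  Real.sq_sqrt (by positivity)

omit hk hl in
theorem continuous_deltaAmp : Continuous (deltaAmp k l) := by unfold deltaAmp; fun_prop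

theorem continuous_one_div_deltaAmp : Continuous (fun x => 1 / deltaAmp k l x) :=
  continuous_const.div continuous_deltaAmp fun x => (deltaAmp_pos hk hl x).ne'

omit hk hl in
theorem periodic_one_div_deltaAmp : Function.Periodic (fun x => 1 / deltaAmp k l x) Real.pi := by
  intro x; simp [deltaAmp]

theorem exists_ellipticF_orderIso : ∃ e : ℝ ≃o ℝ, ∀ s, e s = ellipticF k l s := by
  have hc := continuous_one_div_deltaAmp hk hl
  have hp : ∀ x, 0 < 1 / deltaAmp k l x := fun x => one_div_pos.2 (deltaAmp_pos hk hl x)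
  exact exists_orderIso_primitive hc
    (fun x y hxy => intervalIntegral.intervalIntegral_pos_of_pos (hc.intervalIntegrable x y) hp hxy)
    (periodic_one_div_deltaAmp.tendsto_atTop_intervalIntegral_of_pos' (hc.intervalIntegrable _ _)
      hp Real.pi_pos)
    (periodic_one_div_deltaAmp.tendsto_atBot_intervalIntegral_of_pos' (hc.intervalIntegrable _ _)
      hp Real.pi_pos)

theorem exists_amplitude_orderIso :
    ∃ e : ℝ ≃o ℝ, (∀ s, e s = ellipticF k l s) ∧ ⇑e.symm = amplitude k l := by
  obtain ⟨e, he⟩ := exists_ellipticF_orderIso hk hl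
  refine ⟨e, he, ?_⟩
  have h : ellipticF k l = e := funext fun s => (he s).symm
  ext u
  rw [amplitude, h]
  apply e.injective
  rw [e.apply_symm_apply, Function.invFun_eq (e.surjective u)]

theorem ellipticF_amplitude (u : ℝ) : ellipticF k l (amplitude k l u) = u := by
  obtain ⟨e, he, hs⟩ := exists_amplitude_orderIso hk hl
  rw [← hs, ← he, e.apply_symm_apply]

theorem amplitude_ellipticF (x : ℝ) : amplitude k l (ellipticF k l x) = x := by
  obtain ⟨e, he, hs⟩ := exists_amplitude_orderIso hk hl
  rw [← hs, ← he, e.symm_apply_apply]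

theorem hasDerivAt_amplitude (u : ℝ) : HasDerivAt (amplitude k l) (deltaAm k l u) u := by
  obtain ⟨e, he, hs⟩ := exists_amplitude_orderIso hk hl
  have h0 := (deltaAmp_pos hk hl (e.symm u)).ne'
  have := OrderIso.hasDerivAt_symm_of_primitive (continuous_one_div_deltaAmp hk hl) e he
    (t := u) (by positivity)
  rw [hs] at this
  simpa [deltaAm] using this

/-- The integrand has period `π` and is symmetric about `π / 2`, so a full period contributes two
quarter periods. -/
theorem ellipticF_add_int_mul_pi (x : ℝ) (j : ℤ) :
    ellipticF k l (x + j * Real.pi) = ellipticF k l x + j * (2 * quarterPeriod k l) := by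
  have hc := continuous_one_div_deltaAmp hk hl
  have hi := fun x y => hc.intervalIntegrable (μ := MeasureTheory.volume) x y
  have hhalf : ∫ x in (0 : ℝ)..Real.pi, 1 / deltaAmp k l x = 2 * quarterPeriod k l := by
    rw [← intervalIntegral.integral_add_adjacent_intervals (hi 0 (Real.pi / 2)) (hi _ _)]
    have : ∫ x in (Real.pi / 2)..Real.pi, 1 / deltaAmp k l x
        = ∫ x in (0 : ℝ)..(Real.pi / 2), 1 / deltaAmp k l x := by
      have h := intervalIntegral.integral_comp_sub_left (a := 0) (b := Real.pi / 2)
        (fun x => 1 / deltaAmp k l x) Real.pi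
      rw [sub_zero, show Real.pi - Real.pi / 2 = Real.pi / 2 by ring] at h
      rw [← h]
      simp [deltaAmp]
    rw [this, quarterPeriod, ellipticF]; ring
  have h1 := periodic_one_div_deltaAmp (k := k) (l := l)
    |>.intervalIntegral_add_zsmul_eq j x hi
  rw [periodic_one_div_deltaAmp.intervalIntegral_add_eq x 0, zero_add, hhalf] at h1
  rw [ellipticF, ← intervalIntegral.integral_add_adjacent_intervals (hi 0 x) (hi _ _)]
  simp only [zsmul_eq_mul] at h1
  rw [h1, ellipticF]

omit hk hl in
theorem ellipticF_neg (x : ℝ) : ellipticF k l (-x) = -ellipticF k l x := by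
  have h := intervalIntegral.integral_comp_neg (a := 0) (b := x) (fun x => 1 / deltaAmp k l x)
  rw [ellipticF, ellipticF, intervalIntegral.integral_symm, ← neg_zero (G := ℝ), ← h]
  simp [deltaAmp]

theorem amplitude_add_int_mul (u : ℝ) (j : ℤ) :
    amplitude k l (u + j * (2 * quarterPeriod k l)) = amplitude k l u + j * Real.pi := by
  conv_lhs => rw [← ellipticF_amplitude hk hl u, ← ellipticF_add_int_mul_pi hk hl,
    amplitude_ellipticF hk hl]

theorem quarterPeriod_pos : 0 < quarterPeriod k l := by
  have hc := continuous_one_div_deltaAmp hk hl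
  exact intervalIntegral.intervalIntegral_pos_of_pos (hc.intervalIntegrable _ _)
    (fun x => one_div_pos.2 (deltaAmp_pos hk hl x)) (by positivity)

theorem deltaAm_pos (u : ℝ) : 0 < deltaAm k l u := deltaAmp_pos hk hl _

theorem deltaAm_sq (u : ℝ) : deltaAm k l u ^ 2 = k + l * sinAm k l u ^ 2 := deltaAmp_sq hk hl _

omit hk hl in
theorem cosAm_sq (u : ℝ) : cosAm k l u ^ 2 = 1 - sinAm k l u ^ 2 := Real.cos_sq' _

theorem hasDerivAt_sinAm (u : ℝ) :
    HasDerivAt (sinAm k l) (cosAm k l u * deltaAm k l u) u := (hasDerivAt_amplitude hk hl u).sin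

theorem hasDerivAt_cosAm (u : ℝ) :
    HasDerivAt (cosAm k l) (-(sinAm k l u * deltaAm k l u)) u := by
  simpa using! (hasDerivAt_amplitude hk hl u).cos

theorem hasDerivAt_deltaAm (u : ℝ) :
    HasDerivAt (deltaAm k l) (l * sinAm k l u * cosAm k l u) u := by
  have h := (((hasDerivAt_sinAm hk hl u).pow 2).const_mul l).const_add k
  have h0 := deltaAm_pos hk hl u
  have h2 := h.sqrt (by simp only [Pi.pow_apply]; positivity)
  have h3 : √(k + l * sinAm k l u ^ 2) = deltaAm k l u := rfl
  convert! h2 using 1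
  simp only [Pi.pow_apply]
  rw [h3]
  field_simp
  norm_num
  ring

theorem continuous_amplitude : Continuous (amplitude k l) :=
  continuous_iff_continuousAt.2 fun u => (hasDerivAt_amplitude hk hl u).continuousAt

theorem contDiff_sinAm : ContDiff ℝ 1 (sinAm k l) := by
  have hc := continuous_amplitude hk hl
  refine contDiff_one_iff_deriv.2 ⟨fun u => (hasDerivAt_sinAm hk hl u).differentiableAt, ?_⟩
  rw [show deriv (sinAm k l) = _ from funext fun u => (hasDerivAt_sinAm hk hl u).deriv]
  unfold cosAm deltaAm deltaAmp
  fun_prop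

theorem contDiff_cosAm : ContDiff ℝ 1 (cosAm k l) := by
  have hc := continuous_amplitude hk hl
  refine contDiff_one_iff_deriv.2 ⟨fun u => (hasDerivAt_cosAm hk hl u).differentiableAt, ?_⟩
  rw [show deriv (cosAm k l) = _ from funext fun u => (hasDerivAt_cosAm hk hl u).deriv]
  unfold sinAm deltaAm deltaAmp
  fun_prop

theorem contDiff_deltaAm : ContDiff ℝ 1 (deltaAm k l) := by
  have hc := continuous_amplitude hk hl
  refine contDiff_one_iff_deriv.2 ⟨fun u => (hasDerivAt_deltaAm hk hl u).differentiableAt, ?_⟩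
  rw [show deriv (deltaAm k l) = _ from funext fun u => (hasDerivAt_deltaAm hk hl u).deriv]
  unfold sinAm cosAm
  fun_prop

/-- The zeros are the half-periods; this later locates the umbilic points in the coordinate plane.
-/
theorem sinAm_eq_zero_iff (u : ℝ) :
    sinAm k l u = 0 ↔ ∃ j : ℤ, u = j * (2 * quarterPeriod k l) := by
  rw [sinAm, Real.sin_eq_zero_iff]
  have h0 : ellipticF k l 0 = 0 := by simp [ellipticF]
  refine exists_congr fun j => ⟨fun h => ?_, fun h => ?_⟩
  · rw [← ellipticF_amplitude hk hl u, ← h, ← zero_add (j * Real.pi),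
      ellipticF_add_int_mul_pi hk hl, h0, zero_add]
  · rw [h, ← zero_add (j * (2 * quarterPeriod k l)), amplitude_add_int_mul hk hl, ← h0,
      amplitude_ellipticF hk hl, zero_add]

theorem sinAm_add_four_mul (u : ℝ) (j : ℤ) :
    sinAm k l (u + j * (4 * quarterPeriod k l)) = sinAm k l u := by
  have := amplitude_add_int_mul hk hl u (2 * j)
  rw [sinAm, show u + j * (4 * quarterPeriod k l)
    = u + (2 * j : ℤ) * (2 * quarterPeriod k l) by push_cast; ring, this, sinAm,
    show ((2 * j : ℤ) : ℝ) * Real.pi = j * (2 * Real.pi) by push_cast; ring,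
    Real.sin_add_int_mul_two_pi]

theorem cosAm_add_four_mul (u : ℝ) (j : ℤ) :
    cosAm k l (u + j * (4 * quarterPeriod k l)) = cosAm k l u := by
  have := amplitude_add_int_mul hk hl u (2 * j)
  rw [cosAm, show u + j * (4 * quarterPeriod k l)
    = u + (2 * j : ℤ) * (2 * quarterPeriod k l) by push_cast; ring, this, cosAm,
    show ((2 * j : ℤ) : ℝ) * Real.pi = j * (2 * Real.pi) by push_cast; ring,
    Real.cos_add_int_mul_two_pi]

theorem deltaAm_add_four_mul (u : ℝ) (j : ℤ) :
    deltaAm k l (u + j * (4 * quarterPeriod k l)) = deltaAm k l u := by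
  have := sinAm_add_four_mul hk hl u j
  simp only [sinAm] at this
  simp only [deltaAm, deltaAmp, this]

/-- Sine and cosine determine the amplitude modulo `2π`, which `ellipticF` turns into four quarter
periods. -/
theorem eq_add_of_sinAm_eq_of_cosAm_eq {u v : ℝ} (hs : sinAm k l u = sinAm k l v)
    (hc : cosAm k l u = cosAm k l v) : ∃ j : ℤ, u = v + j * (4 * quarterPeriod k l) := by
  obtain ⟨j, hj⟩ := Real.Angle.angle_eq_iff_two_pi_dvd_sub.1
    (Real.Angle.cos_sin_inj hc hs)
  refine ⟨j, ?_⟩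
  rw [← ellipticF_amplitude hk hl u, ← ellipticF_amplitude hk hl v,
    show amplitude k l u = amplitude k l v + (2 * j : ℤ) * Real.pi by push_cast; linarith,
    ellipticF_add_int_mul_pi hk hl, ellipticF_amplitude hk hl]
  push_cast; ring

theorem amplitude_neg (u : ℝ) : amplitude k l (-u) = -amplitude k l u := by
  conv_lhs => rw [← ellipticF_amplitude hk hl u, ← ellipticF_neg, amplitude_ellipticF hk hl]

theorem exists_sinAm_cosAm_eq {s t : ℝ} (h : s ^ 2 + t ^ 2 = 1) :
    ∃ u, sinAm k l u = s ∧ cosAm k l u = t := by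
  have hn : ‖(⟨t, s⟩ : ℂ)‖ = 1 := by
    rw [Complex.norm_def, Complex.normSq_mk, Real.sqrt_eq_one]; linarith
  have h1 := Complex.norm_mul_cos_arg ⟨t, s⟩
  have h2 := Complex.norm_mul_sin_arg ⟨t, s⟩
  rw [hn, one_mul] at h1 h2
  exact ⟨ellipticF k l (Complex.arg ⟨t, s⟩), by rw [sinAm, amplitude_ellipticF hk hl, h2],
    by rw [cosAm, amplitude_ellipticF hk hl, h1]⟩

/-- Substituting `x = p + r sin² θ`. -/
theorem integral_one_div_sqrt_eq {g : ℝ → ℝ} {p r K : ℝ} (hr : r ≠ 0) (hK : 0 < K)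
    (hg : ∀ θ, |g (p + r * Real.sin θ ^ 2)| =
      (r * Real.sin θ * Real.cos θ * K * deltaAmp k l θ) ^ 2) :
    ∫ x in Ioo (min p (p + r)) (max p (p + r)), 1 / √|g x| = 2 / K * quarterPeriod k l := by
  have hpi := Real.pi_pos
  set F : ℝ → ℝ := fun θ => p + r * Real.sin θ ^ 2 with hF
  have hder : ∀ θ, HasDerivAt F (2 * r * Real.sin θ * Real.cos θ) θ := by
    intro θ
    have := (((Real.hasDerivAt_sin θ).pow 2).const_mul r).const_add p
    convert! this using 1
    simp; ring
  have hsin : ∀ θ ∈ Ioo 0 (Real.pi / 2), 0 < Real.sin θ := fun θ h =>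
    Real.sin_pos_of_pos_of_lt_pi h.1 (by linarith [h.2])
  have hcos : ∀ θ ∈ Ioo 0 (Real.pi / 2), 0 < Real.cos θ := fun θ h =>
    Real.cos_pos_of_mem_Ioo ⟨by linarith [h.1], h.2⟩
  have hinj : InjOn F (Ioo 0 (Real.pi / 2)) := by
    intro x hx y hy hxy
    have h1 : Real.sin x ^ 2 = Real.sin y ^ 2 := by
      have : r * Real.sin x ^ 2 = r * Real.sin y ^ 2 := by simpa [hF] using hxy
      exact mul_left_cancel₀ hr this
    have h2 : Real.sin x = Real.sin y :=
      (sq_eq_sq₀ (hsin x hx).le (hsin y hy).le).1 h1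
    exact Real.injOn_sin ⟨by linarith [hx.1], hx.2.le⟩ ⟨by linarith [hy.1], hy.2.le⟩ h2
  have himg : F '' Ioo 0 (Real.pi / 2) = Ioo (min p (p + r)) (max p (p + r)) := by
    ext x
    constructor
    · rintro ⟨θ, hθ, rfl⟩
      have h1 := hsin θ hθ
      have h2 : Real.sin θ ^ 2 < 1 := by nlinarith [hcos θ hθ, Real.sin_sq_add_cos_sq θ]
      have h3 : 0 < Real.sin θ ^ 2 := by positivity
      rcases hr.lt_or_gt with h | h
      · rw [min_eq_right (by linarith), max_eq_left (by linarith)]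
        constructor <;> simp only [hF] <;> nlinarith
      · rw [min_eq_left (by linarith), max_eq_right (by linarith)]
        constructor <;> simp only [hF] <;> nlinarith
    · intro hx
      have hq : 0 < (x - p) / r ∧ (x - p) / r < 1 := by
        rcases hr.lt_or_gt with h | h
        · rw [min_eq_right (by linarith), max_eq_left (by linarith)] at hx
          exact ⟨div_pos_of_neg_of_neg (by linarith [hx.2]) h,
            by rw [div_lt_one_of_neg h]; linarith [hx.1]⟩
        · rw [min_eq_left (by linarith), max_eq_right (by linarith)] at hx
          exact ⟨div_pos (by linarith [hx.1]) h, by rw [div_lt_one h]; linarith [hx.2]⟩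
      have hs1 : √((x - p) / r) < 1 := by
        rw [Real.sqrt_lt' one_pos]; simpa using hq.2
      refine ⟨Real.arcsin √((x - p) / r), ⟨Real.arcsin_pos.2 (Real.sqrt_pos.2 hq.1),
        Real.arcsin_lt_pi_div_two.2 hs1⟩, ?_⟩
      simp only [hF]
      rw [Real.sin_arcsin (by linarith [Real.sqrt_nonneg ((x - p) / r)]) hs1.le,
        Real.sq_sqrt hq.1.le]
      field_simp
      ring
  -- The Jacobian `2 r sin θ cos θ` cancels the vanishing factors of the root. On the open interval
  -- the substitution is injective, for either sign of `r`.
  rw [← himg, MeasureTheory.integral_image_eq_integral_abs_deriv_smul measurableSet_Ioo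
    (fun θ _ => (hder θ).hasDerivWithinAt) hinj, quarterPeriod, ellipticF,
    intervalIntegral.integral_of_le (by positivity), MeasureTheory.integral_Ioc_eq_integral_Ioo,
    ← MeasureTheory.integral_const_mul]
  refine MeasureTheory.setIntegral_congr_fun measurableSet_Ioo fun θ hθ => ?_
  have h1 := hsin θ hθ
  have h2 := hcos θ hθ
  have h3 := deltaAmp_pos hk hl θ
  have h4 : 0 < |r| := abs_pos.2 hr
  simp only [hF, smul_eq_mul]
  rw [hg, Real.sqrt_sq_eq_abs]
  simp only [abs_mul, abs_of_pos h1, abs_of_pos h2, abs_of_pos h3, abs_of_pos hK, abs_two]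
  field_simp

end Elliptic

end

noncomputable section

/-! ## Curvatures of the ellipsoid -/

/-- The linear map whose quadratic form is `ellipsoidForm a b c`. -/
def ellipsoidOp (a b c : ℝ) : E3 →L[ℝ] E3 :=
  LinearMap.toContinuousLinearMap
    { toFun := fun p => !₂[p 0 / a ^ 2, p 1 / b ^ 2, p 2 / c ^ 2]
      map_add' := fun p q => by ext i; fin_cases i <;> simp [add_div]
      map_smul' := fun r p => by ext i; fin_cases i <;> simp [mul_div_assoc] }

theorem inner_fin_three (p q : E3) : ⟪p, q⟫ = p 0 * q 0 + p 1 * q 1 + p 2 * q 2 := by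
  simp [PiLp.inner_apply, Fin.sum_univ_three]; ring

section Curvature

variable {a b c : ℝ}

theorem ellipsoidOp_apply (p : E3) :
    ellipsoidOp a b c p = !₂[p 0 / a ^ 2, p 1 / b ^ 2, p 2 / c ^ 2] := rfl

theorem inner_ellipsoidOp (p q : E3) :
    ⟪ellipsoidOp a b c p, q⟫ = p 0 * q 0 / a ^ 2 + p 1 * q 1 / b ^ 2 + p 2 * q 2 / c ^ 2 := by
  rw [inner_fin_three, ellipsoidOp_apply]; simp; ring

theorem inner_ellipsoidOp_comm (p q : E3) :
    ⟪ellipsoidOp a b c p, q⟫ = ⟪ellipsoidOp a b c q, p⟫ := by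
  rw [inner_ellipsoidOp, inner_ellipsoidOp]; ring

theorem inner_ellipsoidOp_self (p : E3) : ⟪ellipsoidOp a b c p, p⟫ = ellipsoidForm a b c p := by
  rw [inner_ellipsoidOp, ellipsoidForm]; ring

theorem hasGradientAt_ellipsoidForm (p : E3) :
    HasGradientAt (ellipsoidForm a b c) ((2 : ℝ) • ellipsoidOp a b c p) p := by
  rw [hasGradientAt_iff_hasFDerivAt]
  have h : HasFDerivAt (fun q : E3 => ⟪ellipsoidOp a b c q, q⟫) _ p :=
    (ellipsoidOp a b c).hasFDerivAt.inner ℝ (hasFDerivAt_id p)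
  rw [show ellipsoidForm a b c = fun q => ⟪ellipsoidOp a b c q, q⟫ from
    funext fun q => (inner_ellipsoidOp_self q).symm]
  convert! h using 1
  ext w
  simp only [InnerProductSpace.toDual_apply_apply, ContinuousLinearMap.comp_apply,
    ContinuousLinearMap.prod_apply, fderivInnerCLM_apply, ContinuousLinearMap.id_apply]
  rw [real_inner_smul_left, inner_ellipsoidOp_comm w p]
  ring

theorem unitNormal_ellipsoidForm (p : E3) : unitNormal (ellipsoidForm a b c) p =
    ‖ellipsoidOp a b c p‖⁻¹ • ellipsoidOp a b c p := by
  rw [unitNormal, (hasGradientAt_ellipsoidForm p).gradient, norm_smul, smul_smul]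
  congr 1
  norm_num
  ring

/-- The functional comes from differentiating the normalizing factor. It multiplies the normal
vector, so it disappears against tangent vectors and need not be computed. -/
theorem exists_fderiv_unitNormal {p : E3} (hp : ellipsoidOp a b c p ≠ 0) :
    ∃ φ : E3 →L[ℝ] ℝ, ∀ w, fderiv ℝ (unitNormal (ellipsoidForm a b c)) p w =
      ‖ellipsoidOp a b c p‖⁻¹ • ellipsoidOp a b c w + φ w • ellipsoidOp a b c p := by
  have h1 : DifferentiableAt ℝ (fun q : E3 => ‖ellipsoidOp a b c q‖⁻¹) p :=
    ((ellipsoidOp a b c).differentiableAt.norm ℝ hp).inv (norm_ne_zero_iff.2 hp)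
  have h2 := h1.hasFDerivAt.smul (ellipsoidOp a b c).hasFDerivAt (x := p)
  refine ⟨fderiv ℝ (fun q : E3 => ‖ellipsoidOp a b c q‖⁻¹) p, fun w => ?_⟩
  rw [show unitNormal (ellipsoidForm a b c) =
    fun q => ‖ellipsoidOp a b c q‖⁻¹ • ellipsoidOp a b c q from funext unitNormal_ellipsoidForm]
  erw [h2.fderiv]
  simp only [add_apply, smul_apply,
    ContinuousLinearMap.smulRight_apply]

theorem mem_tangentPlane_iff {p : E3} (hp : ellipsoidOp a b c p ≠ 0) (w : E3) :
    w ∈ tangentPlane (ellipsoidForm a b c) p ↔ ⟪ellipsoidOp a b c p, w⟫ = 0 := by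
  have := norm_ne_zero_iff.2 hp
  rw [tangentPlane, Submodule.mem_orthogonal_singleton_iff_inner_right, unitNormal_ellipsoidForm,
    real_inner_smul_left]
  simp [this]

theorem normalCurvature_ellipsoidForm {p : E3} (hp : ellipsoidOp a b c p ≠ 0) {w : E3}
    (hw : ⟪ellipsoidOp a b c p, w⟫ = 0) : normalCurvature (ellipsoidForm a b c) p w =
      -(‖ellipsoidOp a b c p‖⁻¹ * ⟪ellipsoidOp a b c w, w⟫) / ⟪w, w⟫ := by
  obtain ⟨φ, hφ⟩ := exists_fderiv_unitNormal hp
  rw [normalCurvature, hφ, inner_neg_left, inner_add_left, real_inner_smul_left,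
    real_inner_smul_left, hw, mul_zero, add_zero]

theorem inner_shapeOperator {p : E3} (hp : ellipsoidOp a b c p ≠ 0)
    (v w : tangentPlane (ellipsoidForm a b c) p) :
    ⟪shapeOperator (ellipsoidForm a b c) p v, w⟫ =
      -(‖ellipsoidOp a b c p‖⁻¹ * ⟪ellipsoidOp a b c v, (w : E3)⟫) := by
  obtain ⟨φ, hφ⟩ := exists_fderiv_unitNormal hp
  have hw := (mem_tangentPlane_iff hp (w : E3)).1 w.2
  simp only [shapeOperator, LinearMap.neg_apply, inner_neg_left, ContinuousLinearMap.coe_coe,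
    ContinuousLinearMap.comp_apply, Submodule.subtypeL_apply, hφ]
  rw [Submodule.inner_orthogonalProjectionOnto_eq_of_mem_right]
  rw [inner_add_left, real_inner_smul_left, real_inner_smul_left, hw, mul_zero, add_zero]

/-- `e₁`, `e₂` are orthogonal tangent vectors in principal directions, on which the quotients of
the forms `ellipsoidForm` and `‖·‖²` are `κ₁`, `κ₂`. -/
structure IsPrincipalFrame (a b c : ℝ) (p e₁ e₂ : E3) (κ₁ κ₂ : ℝ) : Prop where
  ne_zero₁ : e₁ ≠ 0
  ne_zero₂ : e₂ ≠ 0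
  tangent₁ : ⟪ellipsoidOp a b c p, e₁⟫ = 0
  tangent₂ : ⟪ellipsoidOp a b c p, e₂⟫ = 0
  orthogonal : ⟪e₁, e₂⟫ = 0
  conjugate : ⟪ellipsoidOp a b c e₁, e₂⟫ = 0
  form₁ : ⟪ellipsoidOp a b c e₁, e₁⟫ = κ₁ * ⟪e₁, e₁⟫
  form₂ : ⟪ellipsoidOp a b c e₂, e₂⟫ = κ₂ * ⟪e₂, e₂⟫

namespace IsPrincipalFrame

variable {p e₁ e₂ : E3} {κ₁ κ₂ : ℝ}

/-- In a frame that is both orthogonal and conjugate, pairing the shape operator with the basis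
shows that each frame vector is an eigenvector. The eigenvalues are negative multiples of the `κ`'s
because the normal is the outward gradient. -/
theorem exists_basis (h : IsPrincipalFrame a b c p e₁ e₂ κ₁ κ₂) (hp : ellipsoidOp a b c p ≠ 0) :
    ∃ B : Module.Basis (Fin 2) ℝ (tangentPlane (ellipsoidForm a b c) p),
      LinearMap.toMatrix B B (shapeOperator (ellipsoidForm a b c) p) =
        Matrix.diagonal ![-(‖ellipsoidOp a b c p‖⁻¹ * κ₁), -(‖ellipsoidOp a b c p‖⁻¹ * κ₂)] := by
  set T := tangentPlane (ellipsoidForm a b c) p with hT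
  let v₁ : T := ⟨e₁, (mem_tangentPlane_iff hp _).2 h.tangent₁⟩
  let v₂ : T := ⟨e₂, (mem_tangentPlane_iff hp _).2 h.tangent₂⟩
  have hn : unitNormal (ellipsoidForm a b c) p ≠ 0 := by
    rw [unitNormal_ellipsoidForm]
    exact smul_ne_zero (inv_ne_zero (norm_ne_zero_iff.2 hp)) hp
  have hfin : Module.finrank ℝ T = 2 := by
    have : Fact (Module.finrank ℝ E3 = 2 + 1) := ⟨by simp [E3]⟩
    exact Submodule.finrank_orthogonal_span_singleton hn
  have hli : LinearIndependent ℝ ![v₁, v₂] := by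
    refine linearIndependent_of_ne_zero_of_inner_eq_zero ?_ ?_
    · intro i
      fin_cases i
      · exact fun h0 => h.ne_zero₁ (congrArg Subtype.val h0)
      · exact fun h0 => h.ne_zero₂ (congrArg Subtype.val h0)
    · intro i j hij
      have h2 := h.orthogonal
      have h3 : ⟪e₂, e₁⟫ = 0 := by rw [real_inner_comm]; exact h2
      fin_cases i <;> fin_cases j <;> simp_all [v₁, v₂]
  let B := basisOfLinearIndependentOfCardEqFinrank hli (by simp [hfin])
  have hB : ∀ i, B i = ![v₁, v₂] i := fun i => by simp [B]
  have hB0 : (B 0 : E3) = e₁ := by rw [hB]; rfl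
  have hB1 : (B 1 : E3) = e₂ := by rw [hB]; rfl
  refine ⟨B, ?_⟩
  have hS : ∀ i, shapeOperator (ellipsoidForm a b c) p (B i) =
      ![-(‖ellipsoidOp a b c p‖⁻¹ * κ₁), -(‖ellipsoidOp a b c p‖⁻¹ * κ₂)] i • B i := by
    intro i
    refine InnerProductSpace.ext_inner_right_basis B fun j => ?_
    rw [inner_shapeOperator hp, Submodule.coe_inner, Submodule.coe_smul, real_inner_smul_left]
    have h1 := h.form₁
    have h2 := h.form₂
    have h3 := h.conjugate
    have h4 : ⟪ellipsoidOp a b c e₂, e₁⟫ = 0 := by rw [inner_ellipsoidOp_comm]; exact h3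
    have h5 := h.orthogonal
    have h6 : ⟪e₂, e₁⟫ = 0 := by rw [real_inner_comm]; exact h5
    fin_cases i <;> fin_cases j <;>
      simp only [Fin.zero_eta, Fin.mk_one, hB0, hB1, h1, h2, h3, h4, h5, h6,
        Matrix.cons_val_zero, Matrix.cons_val_one] <;> ring
  ext i j
  rw [LinearMap.toMatrix_apply, hS, map_smul, B.repr_self]
  fin_cases i <;> fin_cases j <;> simp

theorem gaussCurvature_eq (h : IsPrincipalFrame a b c p e₁ e₂ κ₁ κ₂)
    (hp : ellipsoidOp a b c p ≠ 0) :
    gaussCurvature (ellipsoidForm a b c) p = ‖ellipsoidOp a b c p‖⁻¹ ^ 2 * (κ₁ * κ₂) := by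
  obtain ⟨B, hB⟩ := h.exists_basis hp
  rw [gaussCurvature, ← LinearMap.det_toMatrix B, hB, Matrix.det_diagonal]
  simp; ring

theorem meanCurvature_eq (h : IsPrincipalFrame a b c p e₁ e₂ κ₁ κ₂)
    (hp : ellipsoidOp a b c p ≠ 0) :
    meanCurvature (ellipsoidForm a b c) p = -(‖ellipsoidOp a b c p‖⁻¹ * (κ₁ + κ₂) / 2) := by
  obtain ⟨B, hB⟩ := h.exists_basis hp
  rw [meanCurvature, LinearMap.trace_eq_matrix_trace ℝ B, hB, Matrix.trace_diagonal]
  simp; ring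

/-- `H² - K` is the square of half the difference of the principal curvatures. -/
theorem isUmbilicPt_iff (h : IsPrincipalFrame a b c p e₁ e₂ κ₁ κ₂)
    (hp : ellipsoidOp a b c p ≠ 0) : IsUmbilicPt (ellipsoidForm a b c) p ↔ κ₁ = κ₂ := by
  have h0 := inv_ne_zero (norm_ne_zero_iff.2 hp)
  rw [IsUmbilicPt, h.gaussCurvature_eq hp, h.meanCurvature_eq hp,
    show (-(‖ellipsoidOp a b c p‖⁻¹ * (κ₁ + κ₂) / 2)) ^ 2 -
      ‖ellipsoidOp a b c p‖⁻¹ ^ 2 * (κ₁ * κ₂) = (‖ellipsoidOp a b c p‖⁻¹ * (κ₁ - κ₂) / 2) ^ 2 by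
      ring]
  simp only [ne_eq, OfNat.ofNat_ne_zero, not_false_eq_true, pow_eq_zero_iff, div_eq_zero_iff,
    mul_eq_zero, h0, false_or, or_false, sub_eq_zero]

/-- The directions of normal curvature `K / H` are those which the second fundamental form
bisects. -/
theorem normalCurvature_eq_iff (h : IsPrincipalFrame a b c p e₁ e₂ κ₁ κ₂)
    (hp : ellipsoidOp a b c p ≠ 0) (hκ₁ : 0 < κ₁) (hκ₂ : 0 < κ₂) (hκ : κ₁ ≠ κ₂) {α β : ℝ}
    (hw : α • e₁ + β • e₂ ≠ 0) :
    normalCurvature (ellipsoidForm a b c) p (α • e₁ + β • e₂) =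
      gaussCurvature (ellipsoidForm a b c) p / meanCurvature (ellipsoidForm a b c) p ↔
    α ^ 2 * ⟪ellipsoidOp a b c e₁, e₁⟫ = β ^ 2 * ⟪ellipsoidOp a b c e₂, e₂⟫ := by
  have h0 := inv_ne_zero (norm_ne_zero_iff.2 hp)
  have hw' : ⟪α • e₁ + β • e₂, α • e₁ + β • e₂⟫ ≠ 0 := inner_self_ne_zero.2 hw
  have h1 : ⟪ellipsoidOp a b c e₂, e₁⟫ = 0 := by rw [inner_ellipsoidOp_comm]; exact h.conjugate
  have h2 : ⟪e₂, e₁⟫ = 0 := by rw [real_inner_comm]; exact h.orthogonal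
  have ht : ⟪ellipsoidOp a b c p, α • e₁ + β • e₂⟫ = 0 := by
    rw [inner_add_right, real_inner_smul_right, real_inner_smul_right, h.tangent₁, h.tangent₂]
    ring
  have hexp : ⟪α • e₁ + β • e₂, α • e₁ + β • e₂⟫ = α ^ 2 * ⟪e₁, e₁⟫ + β ^ 2 * ⟪e₂, e₂⟫ := by
    simp only [inner_add_left, inner_add_right, real_inner_smul_left, real_inner_smul_right,
      h.orthogonal, h2]
    ring
  have hexp2 : ⟪ellipsoidOp a b c (α • e₁ + β • e₂), α • e₁ + β • e₂⟫ =
      α ^ 2 * (κ₁ * ⟪e₁, e₁⟫) + β ^ 2 * (κ₂ * ⟪e₂, e₂⟫) := by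
    simp only [map_add, map_smul, inner_add_left, inner_add_right, real_inner_smul_left,
      real_inner_smul_right, h.conjugate, h1, h.form₁, h.form₂]
    ring
  rw [normalCurvature_ellipsoidForm hp ht, h.gaussCurvature_eq hp, h.meanCurvature_eq hp,
    h.form₁, h.form₂, hexp2]
  rw [hexp] at hw' ⊢
  have hs : κ₁ + κ₂ ≠ 0 := (add_pos hκ₁ hκ₂).ne'
  set μ := ‖ellipsoidOp a b c p‖⁻¹
  rw [div_eq_div_iff hw' (by simp [h0, hs])]
  have hd : κ₁ - κ₂ ≠ 0 := sub_ne_zero.2 hκ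
  constructor
  · intro H
    -- After clearing denominators the equation factors, with `κ₁ - κ₂` as a factor; off the umbilic
    -- points it can be cancelled.
    have : μ ^ 2 * ((κ₁ - κ₂) * (α ^ 2 * (κ₁ * ⟪e₁, e₁⟫) - β ^ 2 * (κ₂ * ⟪e₂, e₂⟫))) = 0 := by
      linear_combination 2 * H
    have := (mul_eq_zero.1 ((mul_eq_zero.1 this).resolve_left (pow_ne_zero 2 h0))).resolve_left hd
    linarith
  · intro H
    linear_combination (μ ^ 2 * (κ₁ - κ₂) / 2) * H

end IsPrincipalFrame

end Curvature

end

noncomputable section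

/-! ## Confocal coordinates on the ellipsoid -/

/-- The squared moduli of the two families of elliptic functions that parametrize the ellipsoid. -/
structure ConfocalModuli (a b c m n : ℝ) : Prop where
  c_pos : 0 < c
  c_lt_b : c < b
  b_lt_a : b < a
  m_pos : 0 < m
  n_pos : 0 < n
  add_eq_one : m + n = 1
  confocal : n * a ^ 2 + m * c ^ 2 = b ^ 2

/-- The values are forced by the two linear equations `add_eq_one` and `confocal`. -/
theorem confocalModuli {a b c : ℝ} (hc : 0 < c) (hbc : c < b) (hab : b < a) :
    ConfocalModuli a b c ((a ^ 2 - b ^ 2) / (a ^ 2 - c ^ 2)) ((b ^ 2 - c ^ 2) / (a ^ 2 - c ^ 2)) := by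
  have h1 : 0 < a ^ 2 - b ^ 2 := by nlinarith
  have h2 : 0 < b ^ 2 - c ^ 2 := by nlinarith
  have h3 : 0 < a ^ 2 - c ^ 2 := by linarith
  refine ⟨hc, hbc, hab, by positivity, by positivity, ?_, ?_⟩
  · field_simp; ring
  · field_simp; ring

/-- The ellipsoid in coordinates for which the second fundamental form is a multiple of
`du² + dv²`. -/
def confocalMap (a b c m n u v : ℝ) : E3 :=
  !₂[a * cosAm n m u * deltaAm m n v, b * sinAm n m u * sinAm m n v,
    c * deltaAm n m u * cosAm m n v]

/-- The derivative of `confocalMap` in the first coordinate. -/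
def confocalTangent₁ (a b c m n u v : ℝ) : E3 :=
  !₂[-(a * sinAm n m u * deltaAm n m u * deltaAm m n v),
    b * cosAm n m u * deltaAm n m u * sinAm m n v,
    c * m * sinAm n m u * cosAm n m u * cosAm m n v]

/-- The derivative of `confocalMap` in the second coordinate. -/
def confocalTangent₂ (a b c m n u v : ℝ) : E3 :=
  !₂[a * n * cosAm n m u * sinAm m n v * cosAm m n v,
    b * sinAm n m u * cosAm m n v * deltaAm m n v,
    -(c * deltaAm n m u * sinAm m n v * deltaAm m n v)]

/-- The conformal factor of the second fundamental form, up to normalization. -/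
def confocalFactor (m n u v : ℝ) : ℝ := m * sinAm n m u ^ 2 + n * sinAm m n v ^ 2

/-- The squared speed of the curves `s ↦ (u ± s, v ± s)`. -/
def diagonalSpeedSq (a b c m n u v : ℝ) : ℝ := confocalFactor m n u v *
  (2 * b ^ 2 + (a ^ 2 - b ^ 2) * sinAm n m u ^ 2 - (b ^ 2 - c ^ 2) * sinAm m n v ^ 2)

theorem hasDerivAt_vec_three {f g h : ℝ → ℝ} {f' g' h' t : ℝ} (hf : HasDerivAt f f' t)
    (hg : HasDerivAt g g' t) (hh : HasDerivAt h h' t) :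
    HasDerivAt (fun s => (!₂[f s, g s, h s] : E3)) !₂[f', g', h'] t := by
  rw [hasDerivAt_iff_hasFDerivAt, ← hasFDerivWithinAt_univ, hasFDerivWithinAt_euclidean]
  intro i
  rw [hasDerivAt_iff_hasFDerivAt, ← hasFDerivWithinAt_univ] at hf hg hh
  fin_cases i
  · convert! hf using 1
  · convert! hg using 1
  · convert! hh using 1

/-- `n q` and `-m p` are the roots of a quadratic whose sum and product of roots are given; as their
signs are opposite or zero, the roots cannot be exchanged. -/
theorem eq_of_mul_eq_of_sub_eq {m n p q p' q' : ℝ} (hm : 0 < m) (hn : 0 < n) (hp : 0 ≤ p)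
    (hp' : 0 ≤ p') (hq : 0 ≤ q) (hq' : 0 ≤ q') (hmul : p * q = p' * q')
    (hsub : n * q - m * p = n * q' - m * p') : p = p' := by
  have hfac : (p - p') * (n * q' + m * p) = 0 := by
    linear_combination n * hmul - p * hsub
  have h1 := mul_nonneg hn.le hq
  have h2 := mul_nonneg hn.le hq'
  have h3 := mul_nonneg hm.le hp
  have h4 := mul_nonneg hm.le hp'
  rcases mul_eq_zero.1 hfac with h0 | h0
  · linarith
  · have e1 : m * p = 0 := by linarith
    have e2 : m * p' = 0 := by linarith
    exact mul_left_cancel₀ hm.ne' (e1.trans e2.symm)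

/-- Opposite sign changes would negate the product, so one factor is zero and its sign can be chosen
to match. -/
theorem eq_or_eq_neg_of_mul_eq {s t s' t' : ℝ} (hs : s ^ 2 = s' ^ 2) (ht : t ^ 2 = t' ^ 2)
    (hmul : s * t = s' * t') : (s = s' ∧ t = t') ∨ (s = -s' ∧ t = -t') := by
  rcases sq_eq_sq_iff_eq_or_eq_neg.1 hs with hu | hu <;>
    rcases sq_eq_sq_iff_eq_or_eq_neg.1 ht with hv | hv
  · exact Or.inl ⟨hu, hv⟩
  · rw [hu, hv] at hmul
    rcases mul_eq_zero.1 (show s' * t' = 0 by linarith) with h0 | h0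
    · exact Or.inr ⟨by rw [hu, h0, neg_zero], hv⟩
    · exact Or.inl ⟨hu, by rw [hv, h0, neg_zero]⟩
  · rw [hu, hv] at hmul
    rcases mul_eq_zero.1 (show s' * t' = 0 by linarith) with h0 | h0
    · exact Or.inl ⟨by rw [hu, h0, neg_zero], hv⟩
    · exact Or.inr ⟨hu, by rw [hv, h0, neg_zero]⟩
  · exact Or.inr ⟨hu, hv⟩

namespace ConfocalModuli

variable {a b c m n : ℝ} (h : ConfocalModuli a b c m n)
include h

theorem b_pos : 0 < b := h.c_pos.trans h.c_lt_b
theorem a_pos : 0 < a := h.b_pos.trans h.b_lt_a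

theorem relations (u v : ℝ) : cosAm n m u ^ 2 = 1 - sinAm n m u ^ 2 ∧
    deltaAm n m u ^ 2 = n + m * sinAm n m u ^ 2 ∧ cosAm m n v ^ 2 = 1 - sinAm m n v ^ 2 ∧
    deltaAm m n v ^ 2 = m + n * sinAm m n v ^ 2 ∧ n = 1 - m ∧ b ^ 2 = n * a ^ 2 + m * c ^ 2 :=
  ⟨cosAm_sq u, deltaAm_sq h.n_pos h.m_pos u, cosAm_sq v, deltaAm_sq h.m_pos h.n_pos v,
    by linarith [h.add_eq_one], h.confocal.symm⟩

theorem ellipsoidForm_confocalMap (u v : ℝ) :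
    ellipsoidForm a b c (confocalMap a b c m n u v) = 1 := by
  obtain ⟨h1, h2, h3, h4, h5, -⟩ := h.relations u v
  have := h.a_pos.ne'; have := h.b_pos.ne'; have := h.c_pos.ne'
  simp only [ellipsoidForm, confocalMap, Matrix.cons_val]
  field_simp
  rw [h1, h2, h3, h4, h5]
  ring

theorem ellipsoidOp_confocalMap_ne_zero (u v : ℝ) :
    ellipsoidOp a b c (confocalMap a b c m n u v) ≠ 0 := by
  intro h0
  have h1 := h.ellipsoidForm_confocalMap u v
  rw [← inner_ellipsoidOp_self, h0, inner_zero_left] at h1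
  exact zero_ne_one h1

theorem inner_normal_tangent₁ (u v : ℝ) : ⟪ellipsoidOp a b c (confocalMap a b c m n u v),
    confocalTangent₁ a b c m n u v⟫ = 0 := by
  obtain ⟨h1, h2, h3, h4, h5, -⟩ := h.relations u v
  have := h.a_pos.ne'; have := h.b_pos.ne'; have := h.c_pos.ne'
  simp only [inner_ellipsoidOp, confocalMap, confocalTangent₁, Matrix.cons_val]
  field_simp
  rw [h3, h4, h5]
  ring

theorem inner_normal_tangent₂ (u v : ℝ) : ⟪ellipsoidOp a b c (confocalMap a b c m n u v),
    confocalTangent₂ a b c m n u v⟫ = 0 := by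
  obtain ⟨h1, h2, h3, h4, h5, -⟩ := h.relations u v
  have := h.a_pos.ne'; have := h.b_pos.ne'; have := h.c_pos.ne'
  simp only [inner_ellipsoidOp, confocalMap, confocalTangent₂, Matrix.cons_val]
  field_simp
  rw [h1, h2, h5]
  ring

/-- Orthogonality of the coordinate curves is the relation `confocal`, and their conjugacy in the
next lemma is `add_eq_one`. -/
theorem inner_tangent₁_tangent₂ (u v : ℝ) : ⟪confocalTangent₁ a b c m n u v,
    confocalTangent₂ a b c m n u v⟫ = 0 := by
  obtain ⟨-, -, -, -, -, h6⟩ := h.relations u v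
  simp only [inner_fin_three, confocalTangent₁, confocalTangent₂, Matrix.cons_val]
  linear_combination (sinAm n m u * cosAm n m u * deltaAm n m u * sinAm m n v * cosAm m n v *
    deltaAm m n v) * h6

theorem inner_ellipsoidOp_tangent₁_tangent₂ (u v : ℝ) :
    ⟪ellipsoidOp a b c (confocalTangent₁ a b c m n u v), confocalTangent₂ a b c m n u v⟫ = 0 := by
  have := h.a_pos.ne'; have := h.b_pos.ne'; have := h.c_pos.ne'
  simp only [inner_ellipsoidOp, confocalTangent₁, confocalTangent₂,
    Matrix.cons_val]
  field_simp
  linear_combination -(sinAm n m u * cosAm n m u * deltaAm n m u * sinAm m n v * cosAm m n v *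
    deltaAm m n v) * h.add_eq_one

/-- This value agrees with that of `form_tangent₂`: the coordinates are isothermal for the second
fundamental form, which is why harmonic directions become diagonal. -/
theorem form_tangent₁ (u v : ℝ) : ⟪ellipsoidOp a b c (confocalTangent₁ a b c m n u v),
    confocalTangent₁ a b c m n u v⟫ = confocalFactor m n u v := by
  obtain ⟨h1, h2, h3, h4, h5, -⟩ := h.relations u v
  have := h.a_pos.ne'; have := h.b_pos.ne'; have := h.c_pos.ne'
  simp only [inner_ellipsoidOp, confocalTangent₁, Matrix.cons_val,
    confocalFactor]
  field_simp
  rw [h1, h2, h3, h4, h5]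
  ring

theorem form_tangent₂ (u v : ℝ) : ⟪ellipsoidOp a b c (confocalTangent₂ a b c m n u v),
    confocalTangent₂ a b c m n u v⟫ = confocalFactor m n u v := by
  obtain ⟨h1, h2, h3, h4, h5, -⟩ := h.relations u v
  have := h.a_pos.ne'; have := h.b_pos.ne'; have := h.c_pos.ne'
  simp only [inner_ellipsoidOp, confocalTangent₂, Matrix.cons_val,
    confocalFactor]
  field_simp
  rw [h1, h2, h3, h4, h5]
  ring

theorem inner_tangent₁_self (u v : ℝ) : ⟪confocalTangent₁ a b c m n u v,
    confocalTangent₁ a b c m n u v⟫ =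
      confocalFactor m n u v * (b ^ 2 + (a ^ 2 - b ^ 2) * sinAm n m u ^ 2) := by
  obtain ⟨h1, h2, h3, h4, h5, h6⟩ := h.relations u v
  simp only [inner_fin_three, confocalTangent₁, Matrix.cons_val, confocalFactor]
  ring_nf
  rw [h1, h2, h3, h4, h6, h5]
  ring

theorem inner_tangent₂_self (u v : ℝ) : ⟪confocalTangent₂ a b c m n u v,
    confocalTangent₂ a b c m n u v⟫ =
      confocalFactor m n u v * (b ^ 2 - (b ^ 2 - c ^ 2) * sinAm m n v ^ 2) := by
  obtain ⟨h1, h2, h3, h4, h5, h6⟩ := h.relations u v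
  simp only [inner_fin_three, confocalTangent₂, Matrix.cons_val, confocalFactor]
  ring_nf
  rw [h1, h2, h3, h4, h6, h5]
  ring

omit h in
theorem sinAm_sq_le_one {k l u : ℝ} : sinAm k l u ^ 2 ≤ 1 := Real.sin_sq_le_one _

theorem metric₁_pos (u : ℝ) : 0 < b ^ 2 + (a ^ 2 - b ^ 2) * sinAm n m u ^ 2 := by
  have h1 : 0 < a ^ 2 - b ^ 2 := by nlinarith [h.b_pos, h.b_lt_a]
  have := h.b_pos
  positivity

theorem metric₂_pos (v : ℝ) : 0 < b ^ 2 - (b ^ 2 - c ^ 2) * sinAm m n v ^ 2 := by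
  have h1 : 0 < b ^ 2 - c ^ 2 := by nlinarith [h.c_pos, h.c_lt_b]
  have := h.c_pos
  nlinarith [sq_nonneg (sinAm m n v), sinAm_sq_le_one (k := m) (l := n) (u := v)]

theorem confocalFactor_nonneg (u v : ℝ) : 0 ≤ confocalFactor m n u v := by
  have := h.m_pos; have := h.n_pos
  unfold confocalFactor; positivity

theorem confocalFactor_eq_zero_iff (u v : ℝ) :
    confocalFactor m n u v = 0 ↔ sinAm n m u = 0 ∧ sinAm m n v = 0 := by
  have h1 := h.m_pos; have h2 := h.n_pos
  rw [confocalFactor, add_eq_zero_iff_of_nonneg (by positivity) (by positivity)]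
  simp [h1.ne', h2.ne']

theorem isPrincipalFrame {u v : ℝ} (hW : confocalFactor m n u v ≠ 0) :
    IsPrincipalFrame a b c (confocalMap a b c m n u v) (confocalTangent₁ a b c m n u v)
      (confocalTangent₂ a b c m n u v) (b ^ 2 + (a ^ 2 - b ^ 2) * sinAm n m u ^ 2)⁻¹
      (b ^ 2 - (b ^ 2 - c ^ 2) * sinAm m n v ^ 2)⁻¹ where
  ne_zero₁ h0 := hW (by rw [← h.form_tangent₁ u v, h0, inner_zero_right])
  ne_zero₂ h0 := hW (by rw [← h.form_tangent₂ u v, h0, inner_zero_right])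
  tangent₁ := h.inner_normal_tangent₁ u v
  tangent₂ := h.inner_normal_tangent₂ u v
  orthogonal := h.inner_tangent₁_tangent₂ u v
  conjugate := h.inner_ellipsoidOp_tangent₁_tangent₂ u v
  form₁ := by
    have := (h.metric₁_pos u).ne'
    rw [h.form_tangent₁, h.inner_tangent₁_self]; field_simp
  form₂ := by
    have := (h.metric₂_pos v).ne'
    rw [h.form_tangent₂, h.inner_tangent₂_self]; field_simp

/-- The difference of the sides is `a² - c²` times the conformal factor, so the umbilic points are
exactly the zeros of that factor. -/
theorem metric₁_eq_metric₂_iff (u v : ℝ) : b ^ 2 + (a ^ 2 - b ^ 2) * sinAm n m u ^ 2 =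
    b ^ 2 - (b ^ 2 - c ^ 2) * sinAm m n v ^ 2 ↔ confocalFactor m n u v = 0 := by
  obtain ⟨-, -, -, -, h5, h6⟩ := h.relations u v
  have h0 : a ^ 2 - c ^ 2 ≠ 0 := by nlinarith [h.b_pos, h.c_pos, h.c_lt_b, h.b_lt_a]
  rw [← sub_eq_zero, show b ^ 2 + (a ^ 2 - b ^ 2) * sinAm n m u ^ 2 -
    (b ^ 2 - (b ^ 2 - c ^ 2) * sinAm m n v ^ 2) = (a ^ 2 - c ^ 2) * confocalFactor m n u v by
      rw [confocalFactor, h6, h5]; ring]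
  simp [h0]

/-- The frame at the umbilic points, in the plane of symmetry and orthogonal to it. -/
theorem isPrincipalFrame_umbilic {u v : ℝ} (hW : confocalFactor m n u v = 0) :
    IsPrincipalFrame a b c (confocalMap a b c m n u v) !₂[0, 1, 0]
      !₂[-(a * deltaAm n m u * cosAm m n v), 0, c * cosAm n m u * deltaAm m n v]
      (b ^ 2)⁻¹ (b ^ 2)⁻¹ := by
  obtain ⟨h1, h2, h3, h4, h5, h6⟩ := h.relations u v
  obtain ⟨hu, hv⟩ := (h.confocalFactor_eq_zero_iff u v).1 hW
  have ha := h.a_pos.ne'; have hb := h.b_pos.ne'; have hc := h.c_pos.ne'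
  have hd := (deltaAm_pos h.n_pos h.m_pos u).ne'
  simp only [hu, hv, ne_eq, OfNat.ofNat_ne_zero, not_false_eq_true, zero_pow, mul_zero, add_zero,
    sub_zero] at h1 h2 h3 h4
  refine ⟨fun h0 => ?_, fun h0 => ?_, ?_, ?_, ?_, ?_, ?_, ?_⟩
  · simpa using congrArg (fun p : E3 => p 1) h0
  · have h7 : cosAm m n v ≠ 0 := fun h7 => by rw [h7] at h3; norm_num at h3
    simpa [ha, hd, h7] using congrArg (fun p : E3 => p 0) h0
  · simp [inner_ellipsoidOp, confocalMap, hu]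
  · simp only [inner_ellipsoidOp, confocalMap, Matrix.cons_val]
    field_simp
    ring
  · simp [inner_fin_three]
  · simp [inner_ellipsoidOp]
  · rw [inner_ellipsoidOp, inner_fin_three]; simp
  · rw [inner_ellipsoidOp, inner_fin_three]
    simp only [Matrix.cons_val]
    field_simp
    ring_nf
    rw [h1, h2, h3, h4, h6, h5]
    ring

theorem confocalMap_mem_ellipsoid (u v : ℝ) : confocalMap a b c m n u v ∈ ellipsoid a b c :=
  h.ellipsoidForm_confocalMap u v

theorem confocalMap_mem_umbilics_iff (u v : ℝ) :
    confocalMap a b c m n u v ∈ umbilics a b c ↔ confocalFactor m n u v = 0 := by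
  have hp := h.ellipsoidOp_confocalMap_ne_zero u v
  rw [umbilics, mem_ofPred_eq, and_iff_right (h.confocalMap_mem_ellipsoid u v)]
  by_cases hW : confocalFactor m n u v = 0
  · simp [(h.isPrincipalFrame_umbilic hW).isUmbilicPt_iff hp, hW]
  · rw [(h.isPrincipalFrame hW).isUmbilicPt_iff hp, inv_inj, h.metric₁_eq_metric₂_iff]

theorem hasDerivAt_confocalMap {u v : ℝ → ℝ} {u' v' t : ℝ} (hu : HasDerivAt u u' t)
    (hv : HasDerivAt v v' t) : HasDerivAt (fun s => confocalMap a b c m n (u s) (v s))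
      (u' • confocalTangent₁ a b c m n (u t) (v t) +
        v' • confocalTangent₂ a b c m n (u t) (v t)) t := by
  have s1 := (hasDerivAt_sinAm h.n_pos h.m_pos (u t)).comp t hu
  have c1 := (hasDerivAt_cosAm h.n_pos h.m_pos (u t)).comp t hu
  have d1 := (hasDerivAt_deltaAm h.n_pos h.m_pos (u t)).comp t hu
  have s2 := (hasDerivAt_sinAm h.m_pos h.n_pos (v t)).comp t hv
  have c2 := (hasDerivAt_cosAm h.m_pos h.n_pos (v t)).comp t hv
  have d2 := (hasDerivAt_deltaAm h.m_pos h.n_pos (v t)).comp t hv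
  convert! hasDerivAt_vec_three ((c1.const_mul a).mul d2) ((s1.const_mul b).mul s2)
    ((d1.const_mul c).mul c2) using 1
  ext i
  fin_cases i <;> simp [confocalTangent₁, confocalTangent₂] <;> ring

theorem normSq_diagonal {α β : ℝ} (u v : ℝ) :
    ⟪α • confocalTangent₁ a b c m n u v + β • confocalTangent₂ a b c m n u v,
      α • confocalTangent₁ a b c m n u v + β • confocalTangent₂ a b c m n u v⟫ =
    confocalFactor m n u v * (α ^ 2 * (b ^ 2 + (a ^ 2 - b ^ 2) * sinAm n m u ^ 2) +
      β ^ 2 * (b ^ 2 - (b ^ 2 - c ^ 2) * sinAm m n v ^ 2)) := by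
  have h1 : ⟪confocalTangent₂ a b c m n u v, confocalTangent₁ a b c m n u v⟫ = 0 := by
    rw [real_inner_comm]; exact h.inner_tangent₁_tangent₂ u v
  simp only [inner_add_left, inner_add_right, real_inner_smul_left, real_inner_smul_right,
      h.inner_tangent₁_tangent₂, h1, h.inner_tangent₁_self, h.inner_tangent₂_self]
  ring

/-- Harmonic mean curvature directions are the diagonal directions. -/
theorem normalCurvature_confocal_iff {u v α β : ℝ} (hW : confocalFactor m n u v ≠ 0)
    (hw : α • confocalTangent₁ a b c m n u v + β • confocalTangent₂ a b c m n u v ≠ 0) :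
    normalCurvature (ellipsoidForm a b c) (confocalMap a b c m n u v)
        (α • confocalTangent₁ a b c m n u v + β • confocalTangent₂ a b c m n u v) =
      gaussCurvature (ellipsoidForm a b c) (confocalMap a b c m n u v) /
        meanCurvature (ellipsoidForm a b c) (confocalMap a b c m n u v) ↔ α ^ 2 = β ^ 2 := by
  rw [(h.isPrincipalFrame hW).normalCurvature_eq_iff (h.ellipsoidOp_confocalMap_ne_zero u v)
    (inv_pos.2 (h.metric₁_pos u)) (inv_pos.2 (h.metric₂_pos v))
    (fun h0 => hW ((h.metric₁_eq_metric₂_iff u v).1 (inv_inj.1 h0))) hw,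
    h.form_tangent₁, h.form_tangent₂, mul_left_inj' hW]

theorem diagonalSpeedSq_nonneg (u v : ℝ) : 0 ≤ diagonalSpeedSq a b c m n u v :=
  mul_nonneg (h.confocalFactor_nonneg u v) (by linarith [h.metric₁_pos u, h.metric₂_pos v])

theorem diagonalSpeedSq_pos {u v : ℝ} (hW : confocalFactor m n u v ≠ 0) :
    0 < diagonalSpeedSq a b c m n u v :=
  mul_pos ((h.confocalFactor_nonneg u v).lt_of_ne' hW)
    (by linarith [h.metric₁_pos u, h.metric₂_pos v])

/-- The confocal coordinates cover the ellipsoid. -/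
theorem exists_confocalMap_eq {p : E3} (hp : p ∈ ellipsoid a b c) :
    ∃ u v, confocalMap a b c m n u v = p := by
  have ha := h.a_pos; have hb := h.b_pos; have hc := h.c_pos
  have hm := h.m_pos; have hn := h.n_pos; have hmn := h.add_eq_one
  obtain ⟨x, hx⟩ : ∃ x, p 0 = a * x := ⟨p 0 / a, by field_simp⟩
  obtain ⟨y, hy⟩ : ∃ y, p 1 = b * y := ⟨p 1 / b, by field_simp⟩
  obtain ⟨z, hz⟩ : ∃ z, p 2 = c * z := ⟨p 2 / c, by field_simp⟩
  have hS : x ^ 2 + y ^ 2 + z ^ 2 = 1 := by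
    have : ellipsoidForm a b c p = 1 := hp
    rw [ellipsoidForm, hx, hy, hz] at this
    field_simp at this
    linarith
  -- `n q` and `-m r` are the roots of `T² - σ T - m n y²`
  set σ := x ^ 2 - m + n * y ^ 2 with hσ
  set R := √(σ ^ 2 + 4 * m * n * y ^ 2) with hR
  have hR0 : 0 ≤ R := Real.sqrt_nonneg _
  have hR2 : R ^ 2 = σ ^ 2 + 4 * m * n * y ^ 2 := Real.sq_sqrt (by positivity)
  have hR1 : |σ| ≤ R := abs_le_of_sq_le_sq (by rw [hR2]; nlinarith [mul_pos hm hn, sq_nonneg y]) hR0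
  have hy1 := sq_nonneg y; have hx1 := sq_nonneg x; have hz1 := sq_nonneg z
  have hnm : n = 1 - m := by linarith
  -- This bound and the next give `q ≤ 1` and `r ≤ 1`, so that `q` and `r` can be squared sines. The
  -- differences of squares are `4 n z²` and `4 m x²`.
  have hRn : R ≤ 2 * n - σ := by
    refine abs_le_of_sq_le_sq' ?_ ?_ |>.2
    · have : (2 * n - σ) ^ 2 - R ^ 2 = 4 * n * z ^ 2 := by
        rw [hR2, hσ, show z ^ 2 = 1 - x ^ 2 - y ^ 2 by linarith, hnm]; ring
      nlinarith [mul_nonneg hn.le hz1]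
    · rw [hσ]; nlinarith [mul_nonneg hm.le hy1]
  have hRm : R ≤ 2 * m + σ := by
    refine abs_le_of_sq_le_sq' ?_ ?_ |>.2
    · have : (2 * m + σ) ^ 2 - R ^ 2 = 4 * m * x ^ 2 := by
        rw [hR2, hσ, hnm]; ring
      nlinarith [mul_nonneg hm.le hx1]
    · rw [hσ]; nlinarith [mul_nonneg hn.le hy1]
  obtain ⟨q, hq⟩ : ∃ q, (σ + R) / 2 = n * q := ⟨(σ + R) / 2 / n, by field_simp⟩
  obtain ⟨r, hr⟩ : ∃ r, (R - σ) / 2 = m * r := ⟨(R - σ) / 2 / m, by field_simp⟩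
  have hq0 : 0 ≤ q := by
    by_contra hlt; push Not at hlt
    nlinarith [mul_neg_of_pos_of_neg hn hlt, neg_abs_le σ]
  have hr0 : 0 ≤ r := by
    by_contra hlt; push Not at hlt
    nlinarith [mul_neg_of_pos_of_neg hm hlt, le_abs_self σ]
  have hq1 : q ≤ 1 := by
    by_contra hlt; push Not at hlt
    nlinarith
  have hr1 : r ≤ 1 := by
    by_contra hlt; push Not at hlt
    nlinarith
  have hqr : r * q = y ^ 2 := by
    have : n * q * (m * r) = m * n * y ^ 2 := by rw [← hq, ← hr]; linarith
    have h0 : (m * n) * (r * q) = (m * n) * y ^ 2 := by linarith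
    exact mul_left_cancel₀ (mul_pos hm hn).ne' h0
  have hsub : n * q - m * r = σ := by rw [← hq, ← hr]; ring
  have hxx : x ^ 2 = (1 - r) * (m + n * q) := by
    have : x ^ 2 = σ + m - n * y ^ 2 := by rw [hσ]; ring
    rw [this, ← hsub, ← hqr, hnm]; ring
  have hzz : z ^ 2 = (1 - q) * (n + m * r) := by
    have : z ^ 2 = 1 - x ^ 2 - y ^ 2 := by linarith
    rw [this, hxx, ← hqr, hnm]; ring
  have hdu : 0 < √(n + m * r) := Real.sqrt_pos.2 (by positivity)
  have hdv : 0 < √(m + n * q) := Real.sqrt_pos.2 (by positivity)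
  have hdu2 : √(n + m * r) ^ 2 = n + m * r := Real.sq_sqrt (by positivity)
  have hdv2 : √(m + n * q) ^ 2 = m + n * q := Real.sq_sqrt (by positivity)
  -- choice of the sign of `y`
  obtain ⟨s, t, hs, ht, hst⟩ : ∃ s t : ℝ, s ^ 2 = r ∧ t ^ 2 = q ∧ s * t = y := by
    have habs : √r * √q = |y| := by rw [← Real.sqrt_mul hr0, hqr, Real.sqrt_sq_eq_abs]
    rcases le_total 0 y with h0 | h0
    · exact ⟨√r, √q, Real.sq_sqrt hr0, Real.sq_sqrt hq0, by rw [habs, abs_of_nonneg h0]⟩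
    · exact ⟨-√r, √q, by rw [neg_sq, Real.sq_sqrt hr0], Real.sq_sqrt hq0,
        by rw [neg_mul, habs, abs_of_nonpos h0, neg_neg]⟩
  obtain ⟨u, hu1, hu2⟩ := exists_sinAm_cosAm_eq hn hm (s := s) (t := x / √(m + n * q)) (by
    rw [div_pow, hdv2, hxx, hs, mul_div_assoc, div_self (by positivity)]; ring)
  obtain ⟨v, hv1, hv2⟩ := exists_sinAm_cosAm_eq hm hn (s := t) (t := z / √(n + m * r)) (by
    rw [div_pow, hdu2, hzz, ht, mul_div_assoc, div_self (by positivity)]; ring)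
  have hu3 : deltaAm n m u = √(n + m * r) := by
    rw [deltaAm, deltaAmp, ← hs, ← hu1]; rfl
  have hv3 : deltaAm m n v = √(m + n * q) := by
    rw [deltaAm, deltaAmp, ← ht, ← hv1]; rfl
  refine ⟨u, v, ?_⟩
  ext i
  fin_cases i
  · simp only [confocalMap, Fin.zero_eta, PiLp.toLp_apply, Matrix.cons_val, hu2, hv3, hx]
    field_simp
  · simp only [confocalMap, Fin.mk_one, PiLp.toLp_apply, Matrix.cons_val, hu1, hv1, hy, ← hst]
    ring
  · simp only [confocalMap, Fin.reduceFinMk, PiLp.toLp_apply, Matrix.cons_val, hu3, hv2, hz]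
    field_simp

theorem confocalMap_add_int_mul (u v : ℝ) (i j : ℤ) :
    confocalMap a b c m n (u + i * (4 * quarterPeriod n m)) (v + j * (4 * quarterPeriod m n)) =
      confocalMap a b c m n u v := by
  have hm := h.m_pos; have hn := h.n_pos
  simp only [confocalMap, sinAm_add_four_mul hm hn, sinAm_add_four_mul hn hm,
    cosAm_add_four_mul hm hn, cosAm_add_four_mul hn hm, deltaAm_add_four_mul hm hn,
    deltaAm_add_four_mul hn hm]

theorem diagonalSpeedSq_add_int_mul (u v : ℝ) (i j : ℤ) :
    diagonalSpeedSq a b c m n (u + i * (4 * quarterPeriod n m)) (v + j * (4 * quarterPeriod m n)) =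
      diagonalSpeedSq a b c m n u v := by
  have hm := h.m_pos; have hn := h.n_pos
  simp only [diagonalSpeedSq, confocalFactor, sinAm_add_four_mul hm hn, sinAm_add_four_mul hn hm]

/-- The confocal coordinates are unique up to sign and periods. -/
theorem eq_of_confocalMap_eq {u v u' v' : ℝ}
    (heq : confocalMap a b c m n u v = confocalMap a b c m n u' v') :
    (∃ i j : ℤ, u = u' + i * (4 * quarterPeriod n m) ∧ v = v' + j * (4 * quarterPeriod m n)) ∨
    (∃ i j : ℤ, u = -u' + i * (4 * quarterPeriod n m) ∧ v = -v' + j * (4 * quarterPeriod m n)) := by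
  have ha := h.a_pos; have hb := h.b_pos; have hc := h.c_pos
  have hm := h.m_pos; have hn := h.n_pos
  obtain ⟨h1, h2, h3, h4, h5, -⟩ := h.relations u v
  obtain ⟨k1, k2, k3, k4, -, -⟩ := h.relations u' v'
  have e0 : cosAm n m u * deltaAm m n v = cosAm n m u' * deltaAm m n v' := by
    have := congrArg (fun p : E3 => p 0) heq
    simp only [confocalMap, PiLp.toLp_apply, Matrix.cons_val] at this
    exact mul_left_cancel₀ ha.ne' (by linarith)
  have e1 : sinAm n m u * sinAm m n v = sinAm n m u' * sinAm m n v' := by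
    have := congrArg (fun p : E3 => p 1) heq
    simp only [confocalMap, PiLp.toLp_apply, Matrix.cons_val] at this
    exact mul_left_cancel₀ hb.ne' (by linarith)
  have e2 : deltaAm n m u * cosAm m n v = deltaAm n m u' * cosAm m n v' := by
    have := congrArg (fun p : E3 => p 2) heq
    simp only [confocalMap, PiLp.toLp_apply, Matrix.cons_val] at this
    exact mul_left_cancel₀ hc.ne' (by linarith)
  have s0 := congrArg (· ^ 2) e0
  have s1 := congrArg (· ^ 2) e1
  simp only [mul_pow, h1, h4, k1, k4] at s0 s1
  have hpos : 0 ≤ sinAm n m u ^ 2 := sq_nonneg _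
  have hpos' : 0 ≤ sinAm n m u' ^ 2 := sq_nonneg _
  have hposv : 0 ≤ sinAm m n v ^ 2 := sq_nonneg _
  have hposv' : 0 ≤ sinAm m n v' ^ 2 := sq_nonneg _
  -- Squares of the first two coordinates give the difference and the product of the squared sines,
  -- which together determine them.
  have hdiff : n * sinAm m n v ^ 2 - m * sinAm n m u ^ 2 =
      n * sinAm m n v' ^ 2 - m * sinAm n m u' ^ 2 := by linear_combination s0 + n * s1
  have hsu : sinAm n m u ^ 2 = sinAm n m u' ^ 2 :=
    eq_of_mul_eq_of_sub_eq hm hn hpos hpos' hposv hposv' s1 hdiff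
  have hsv : sinAm m n v ^ 2 = sinAm m n v' ^ 2 :=
    mul_left_cancel₀ hn.ne' (by rw [hsu] at hdiff; linarith)
  have hdu : deltaAm n m u = deltaAm n m u' :=
    (sq_eq_sq₀ (deltaAm_pos hn hm u).le (deltaAm_pos hn hm u').le).1 (by rw [h2, k2, hsu])
  have hdv : deltaAm m n v = deltaAm m n v' :=
    (sq_eq_sq₀ (deltaAm_pos hm hn v).le (deltaAm_pos hm hn v').le).1 (by rw [h4, k4, hsv])
  have hcu : cosAm n m u = cosAm n m u' := by
    rw [hdv] at e0; exact mul_right_cancel₀ (deltaAm_pos hm hn v').ne' e0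
  have hcv : cosAm m n v = cosAm m n v' := by
    rw [hdu] at e2; exact mul_left_cancel₀ (deltaAm_pos hn hm u').ne' e2
  have neg_s : ∀ k l x, 0 < k → 0 < l → sinAm k l (-x) = -sinAm k l x := fun k l x hk hl => by
    rw [sinAm, amplitude_neg hk hl, Real.sin_neg, sinAm]
  have neg_c : ∀ k l x, 0 < k → 0 < l → cosAm k l (-x) = cosAm k l x := fun k l x hk hl => by
    rw [cosAm, amplitude_neg hk hl, Real.cos_neg, cosAm]
  -- `deltaAm` is positive, so both cosines are determined; only a simultaneous sign change of the
  -- two sines remains. It is the involution `(u, v) ↦ (-u, -v)`.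
  have hcase := eq_or_eq_neg_of_mul_eq hsu hsv e1
  rcases hcase with ⟨hu, hv⟩ | ⟨hu, hv⟩
  · obtain ⟨i, hi⟩ := eq_add_of_sinAm_eq_of_cosAm_eq hn hm hu hcu
    obtain ⟨j, hj⟩ := eq_add_of_sinAm_eq_of_cosAm_eq hm hn hv hcv
    exact Or.inl ⟨i, j, hi, hj⟩
  · obtain ⟨i, hi⟩ := eq_add_of_sinAm_eq_of_cosAm_eq hn hm (u := u) (v := -u')
      (by rw [hu, neg_s _ _ _ hn hm]) (by rw [hcu, neg_c _ _ _ hn hm])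
    obtain ⟨j, hj⟩ := eq_add_of_sinAm_eq_of_cosAm_eq hm hn (u := v) (v := -v')
      (by rw [hv, neg_s _ _ _ hm hn]) (by rw [hcv, neg_c _ _ _ hm hn])
    exact Or.inr ⟨i, j, hi, hj⟩

end ConfocalModuli

end

noncomputable section

/-! ## Diagonal lines in confocal coordinates -/

/-- The speed of the curve `s ↦ (u₀ + d₁ s, v₀ + d₂ s)` on the ellipsoid. -/
def diagonalSpeed (a b c m n u₀ v₀ d₁ d₂ s : ℝ) : ℝ :=
  √(diagonalSpeedSq a b c m n (u₀ + d₁ * s) (v₀ + d₂ * s))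

/-- Arc length along a diagonal line. -/
def diagonalLength (a b c m n u₀ v₀ d₁ d₂ s : ℝ) : ℝ :=
  ∫ x in (0 : ℝ)..s, diagonalSpeed a b c m n u₀ v₀ d₁ d₂ x

/-- The inverse of the arc length along a diagonal line. -/
def diagonalParam (a b c m n u₀ v₀ d₁ d₂ : ℝ) : ℝ → ℝ :=
  Function.invFun (diagonalLength a b c m n u₀ v₀ d₁ d₂)

/-- A diagonal line, parametrized by arc length, across umbilic points if need be. -/
def diagonalLine (a b c m n u₀ v₀ d₁ d₂ t : ℝ) : E3 :=
  confocalMap a b c m n (u₀ + d₁ * diagonalParam a b c m n u₀ v₀ d₁ d₂ t)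
    (v₀ + d₂ * diagonalParam a b c m n u₀ v₀ d₁ d₂ t)

/-- The times at which a diagonal line is outside the umbilic points. -/
def regularTimes (a b c m n u₀ v₀ d₁ d₂ : ℝ) : Set ℝ :=
  {t | confocalFactor m n (u₀ + d₁ * diagonalParam a b c m n u₀ v₀ d₁ d₂ t)
    (v₀ + d₂ * diagonalParam a b c m n u₀ v₀ d₁ d₂ t) ≠ 0}

/-- If the function vanished on an interval, so would its derivative there; but at a zero of the
sine the cosine is `±1` and `deltaAm` is positive. -/
theorem exists_sinAm_ne_zero {k l u₀ d x y : ℝ} (hk : 0 < k) (hl : 0 < l)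
    (hd : d ^ 2 = 1) (hxy : x < y) : ∃ z ∈ Ioo x y, sinAm k l (u₀ + d * z) ≠ 0 := by
  by_contra! hcon
  set z := (x + y) / 2 with hz
  have hmem : z ∈ Ioo x y := ⟨by linarith, by linarith⟩
  have h1 : HasDerivAt (fun z => u₀ + d * z) d z := by
    simpa using ((hasDerivAt_id z).const_mul d).const_add u₀
  have h2 := (hasDerivAt_sinAm hk hl (u₀ + d * z)).comp z h1
  have h3 : HasDerivAt (sinAm k l ∘ fun z => u₀ + d * z) 0 z :=
    (hasDerivAt_const z (0 : ℝ)).congr_of_eventuallyEq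
      (eventually_of_mem (Ioo_mem_nhds hmem.1 hmem.2) hcon)
  have h4 := h2.unique h3
  have h5 := cosAm_sq (k := k) (l := l) (u₀ + d * z)
  rw [hcon z hmem] at h5
  have h6 := (deltaAm_pos hk hl (u₀ + d * z)).ne'
  rcases mul_eq_zero.1 h4 with h | h
  · rcases mul_eq_zero.1 h with h | h
    · rw [h] at h5; norm_num at h5
    · exact h6 h
  · rw [h] at hd; norm_num at hd

theorem integral_pos_of_exists_ne_zero {f : ℝ → ℝ} (hf : Continuous f) (h0 : ∀ x, 0 ≤ f x)
    {x y : ℝ} (hxy : x < y) (h : ∃ z ∈ Ioo x y, f z ≠ 0) : 0 < ∫ s in x..y, f s := by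
  obtain ⟨z, hz, hfz⟩ := h
  exact intervalIntegral.integral_pos hxy hf.continuousOn (fun s _ => h0 s)
    ⟨z, Ioo_subset_Icc_self hz, (h0 z).lt_of_ne' hfz⟩

namespace ConfocalModuli

variable {a b c m n : ℝ} (h : ConfocalModuli a b c m n)
include h

theorem continuous_confocalFactor {u v : ℝ → ℝ} (hu : Continuous u) (hv : Continuous v) :
    Continuous fun s => confocalFactor m n (u s) (v s) := by
  have h1 := (contDiff_sinAm h.n_pos h.m_pos).continuous
  have h2 := (contDiff_sinAm h.m_pos h.n_pos).continuous
  unfold confocalFactor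
  fun_prop

/-- The extra radial coordinate gives a map between spaces of dimension three, to which the inverse
function theorem applies directly. -/
theorem contDiff_scaled_confocalMap :
    ContDiff ℝ 1 fun q : ℝ × ℝ × ℝ => q.2.2 • confocalMap a b c m n q.1 q.2.1 := by
  have h1 := contDiff_sinAm h.n_pos h.m_pos
  have h2 := contDiff_sinAm h.m_pos h.n_pos
  have h3 := contDiff_cosAm h.n_pos h.m_pos
  have h4 := contDiff_cosAm h.m_pos h.n_pos
  have h5 := contDiff_deltaAm h.n_pos h.m_pos
  have h6 := contDiff_deltaAm h.m_pos h.n_pos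
  refine contDiff_euclidean.2 fun i => ?_
  fin_cases i <;> simp [confocalMap] <;> fun_prop

theorem continuous_confocalMap {u v : ℝ → ℝ} (hu : Continuous u) (hv : Continuous v) :
    Continuous fun s => confocalMap a b c m n (u s) (v s) := by
  have := h.contDiff_scaled_confocalMap.continuous.comp
    (hu.prodMk (hv.prodMk (continuous_const (y := (1 : ℝ)))))
  simpa [Function.comp_def] using this

theorem continuous_diagonalSpeed (u₀ v₀ d₁ d₂ : ℝ) :
    Continuous (diagonalSpeed a b c m n u₀ v₀ d₁ d₂) := by
  have h1 := (contDiff_sinAm h.n_pos h.m_pos).continuous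
  have h2 := (contDiff_sinAm h.m_pos h.n_pos).continuous
  unfold diagonalSpeed diagonalSpeedSq confocalFactor
  fun_prop

/-- The speed along the line need not be periodic. This lower bound depends on `u` alone, so it is
periodic, and it forces infinite length in both directions. -/
theorem le_diagonalSpeed (u₀ v₀ d₁ d₂ s : ℝ) :
    |b * √m * sinAm n m (u₀ + d₁ * s)| ≤ diagonalSpeed a b c m n u₀ v₀ d₁ d₂ s := by
  refine Real.abs_le_sqrt ?_
  rw [mul_pow, mul_pow, Real.sq_sqrt h.m_pos.le, diagonalSpeedSq, confocalFactor]
  have h1 := h.metric₂_pos (v₀ + d₂ * s)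
  have hab : 0 < a ^ 2 - b ^ 2 := by nlinarith [h.b_pos, h.b_lt_a]
  set p := sinAm n m (u₀ + d₁ * s) ^ 2 with hp
  set q := sinAm m n (v₀ + d₂ * s) ^ 2 with hq
  have hp0 : 0 ≤ p := sq_nonneg _
  have hq0 : 0 ≤ q := sq_nonneg _
  have hm := h.m_pos; have hn := h.n_pos
  have h2 : 0 ≤ (a ^ 2 - b ^ 2) * p := by positivity
  calc b ^ 2 * m * p = (m * p) * b ^ 2 := by ring
    _ ≤ (m * p + n * q) * b ^ 2 := by
      have := mul_nonneg (mul_nonneg hn.le hq0) (sq_nonneg b); linarith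
    _ ≤ _ := by
      refine mul_le_mul_of_nonneg_left ?_ (by positivity)
      linarith

/-- Although the speed may vanish at umbilic points, the periodic minorant has positive integral
over every interval, so arc length is strictly increasing and unbounded both ways. -/
theorem exists_diagonalLength_orderIso {d₁ : ℝ} (hd₁ : d₁ ^ 2 = 1) (u₀ v₀ d₂ : ℝ) :
    ∃ e : ℝ ≃o ℝ, ∀ s, e s = diagonalLength a b c m n u₀ v₀ d₁ d₂ s := by
  have hb := h.b_pos; have hm := h.m_pos; have hn := h.n_pos
  set f := diagonalSpeed a b c m n u₀ v₀ d₁ d₂ with hf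
  set g : ℝ → ℝ := fun s => |b * √m * sinAm n m (u₀ + d₁ * s)| with hg
  have hfc : Continuous f := h.continuous_diagonalSpeed _ _ _ _
  have hgc : Continuous g := by
    have h1 := (contDiff_sinAm h.n_pos h.m_pos).continuous
    simp only [hg]; fun_prop
  have hgf : ∀ s, g s ≤ f s := h.le_diagonalSpeed u₀ v₀ d₁ d₂
  have hg0 : ∀ s, 0 ≤ g s := fun s => abs_nonneg _
  have hpos : ∀ x y, x < y → 0 < ∫ s in x..y, g s := fun x y hxy => by
    obtain ⟨z, hz, hz'⟩ := exists_sinAm_ne_zero (u₀ := u₀) hn hm hd₁ hxy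
    refine integral_pos_of_exists_ne_zero hgc hg0 hxy ⟨z, hz, abs_ne_zero.2 ?_⟩
    have := Real.sqrt_pos.2 hm
    positivity
  have hmono : ∀ x y, x ≤ y → ∫ s in x..y, g s ≤ ∫ s in x..y, f s := fun x y hxy =>
    intervalIntegral.integral_mono hxy (hgc.intervalIntegrable _ _) (hfc.intervalIntegrable _ _) hgf
  have hper : Function.Periodic g (4 * quarterPeriod n m) := by
    intro s
    simp only [hg]
    rcases sq_eq_sq_iff_eq_or_eq_neg.1 (hd₁.trans (one_pow 2).symm) with rfl | rfl
    · have := sinAm_add_four_mul hn hm (u₀ + 1 * s) 1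
      rw [← this]; congr 3; push_cast; ring
    · have := sinAm_add_four_mul hn hm (u₀ + -1 * s) (-1)
      rw [← this]; congr 3; push_cast; ring
  have hq : 0 < 4 * quarterPeriod n m := by linarith [quarterPeriod_pos hn hm]
  refine exists_orderIso_primitive hfc (fun x y hxy => (hpos x y hxy).trans_le (hmono x y hxy.le))
    (tendsto_atTop_mono' _ ?_ (hper.tendsto_atTop_intervalIntegral_of_pos (hpos _ _ hq) hq))
    (tendsto_atBot_mono' _ ?_ (hper.tendsto_atBot_intervalIntegral_of_pos (hpos _ _ hq) hq))
  · filter_upwards [eventually_ge_atTop 0] with s hs using hmono 0 s hs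
  · filter_upwards [eventually_le_atBot 0] with s hs
    rw [intervalIntegral.integral_symm, intervalIntegral.integral_symm s]
    exact neg_le_neg (hmono s 0 hs)

theorem exists_diagonalParam_orderIso {d₁ : ℝ} (hd₁ : d₁ ^ 2 = 1) (u₀ v₀ d₂ : ℝ) :
    ∃ e : ℝ ≃o ℝ, (∀ s, e s = diagonalLength a b c m n u₀ v₀ d₁ d₂ s) ∧
      ⇑e.symm = diagonalParam a b c m n u₀ v₀ d₁ d₂ := by
  obtain ⟨e, he⟩ := h.exists_diagonalLength_orderIso hd₁ u₀ v₀ d₂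
  refine ⟨e, he, ?_⟩
  have h : diagonalLength a b c m n u₀ v₀ d₁ d₂ = e := funext fun s => (he s).symm
  ext u
  rw [diagonalParam, h]
  apply e.injective
  rw [e.apply_symm_apply, Function.invFun_eq (e.surjective u)]

section Param

variable {d₁ : ℝ} (hd₁ : d₁ ^ 2 = 1) (u₀ v₀ d₂ : ℝ)
include hd₁

theorem diagonalParam_diagonalLength (s : ℝ) :
    diagonalParam a b c m n u₀ v₀ d₁ d₂ (diagonalLength a b c m n u₀ v₀ d₁ d₂ s) = s := by
  obtain ⟨e, he, hs⟩ := h.exists_diagonalParam_orderIso hd₁ u₀ v₀ d₂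
  rw [← hs, ← he, e.symm_apply_apply]

theorem diagonalLength_diagonalParam (t : ℝ) :
    diagonalLength a b c m n u₀ v₀ d₁ d₂ (diagonalParam a b c m n u₀ v₀ d₁ d₂ t) = t := by
  obtain ⟨e, he, hs⟩ := h.exists_diagonalParam_orderIso hd₁ u₀ v₀ d₂
  rw [← hs, ← he, e.apply_symm_apply]

theorem strictMono_diagonalLength : StrictMono (diagonalLength a b c m n u₀ v₀ d₁ d₂) := by
  obtain ⟨e, he, -⟩ := h.exists_diagonalParam_orderIso hd₁ u₀ v₀ d₂
  rw [show diagonalLength a b c m n u₀ v₀ d₁ d₂ = e from funext fun s => (he s).symm]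
  exact e.strictMono

theorem strictMono_diagonalParam : StrictMono (diagonalParam a b c m n u₀ v₀ d₁ d₂) := by
  obtain ⟨e, -, hs⟩ := h.exists_diagonalParam_orderIso hd₁ u₀ v₀ d₂
  exact hs ▸ e.symm.strictMono

theorem continuous_diagonalParam : Continuous (diagonalParam a b c m n u₀ v₀ d₁ d₂) := by
  obtain ⟨e, -, hs⟩ := h.exists_diagonalParam_orderIso hd₁ u₀ v₀ d₂
  exact hs ▸ e.symm.continuous

theorem diagonalParam_zero : diagonalParam a b c m n u₀ v₀ d₁ d₂ 0 = 0 := by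
  have := h.diagonalParam_diagonalLength hd₁ u₀ v₀ d₂ 0
  simpa [diagonalLength] using this

theorem diagonalLine_zero : diagonalLine a b c m n u₀ v₀ d₁ d₂ 0 = confocalMap a b c m n u₀ v₀ := by
  simp [diagonalLine, h.diagonalParam_zero hd₁]

theorem hasDerivAt_diagonalParam {t : ℝ} (ht : t ∈ regularTimes a b c m n u₀ v₀ d₁ d₂) :
    HasDerivAt (diagonalParam a b c m n u₀ v₀ d₁ d₂)
      (diagonalSpeed a b c m n u₀ v₀ d₁ d₂ (diagonalParam a b c m n u₀ v₀ d₁ d₂ t))⁻¹ t := by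
  obtain ⟨e, he, hs⟩ := h.exists_diagonalParam_orderIso hd₁ u₀ v₀ d₂
  rw [← hs]
  refine OrderIso.hasDerivAt_symm_of_primitive (h.continuous_diagonalSpeed _ _ _ _) e he ?_
  rw [hs]
  exact (Real.sqrt_pos.2 (h.diagonalSpeedSq_pos ht)).ne'

theorem continuous_diagonalLine : Continuous (diagonalLine a b c m n u₀ v₀ d₁ d₂) := by
  have := h.continuous_diagonalParam hd₁ u₀ v₀ d₂
  exact h.continuous_confocalMap (by fun_prop) (by fun_prop)

theorem isOpen_regularTimes : IsOpen (regularTimes a b c m n u₀ v₀ d₁ d₂) := by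
  have := h.continuous_diagonalParam hd₁ u₀ v₀ d₂
  exact isOpen_ne.preimage (h.continuous_confocalFactor
    (u := fun t => u₀ + d₁ * diagonalParam a b c m n u₀ v₀ d₁ d₂ t)
    (v := fun t => v₀ + d₂ * diagonalParam a b c m n u₀ v₀ d₁ d₂ t) (by fun_prop) (by fun_prop))

theorem hasDerivAt_diagonalLine {t : ℝ} (ht : t ∈ regularTimes a b c m n u₀ v₀ d₁ d₂) :
    HasDerivAt (diagonalLine a b c m n u₀ v₀ d₁ d₂)
      ((d₁ * (diagonalSpeed a b c m n u₀ v₀ d₁ d₂ (diagonalParam a b c m n u₀ v₀ d₁ d₂ t))⁻¹) •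
        confocalTangent₁ a b c m n (u₀ + d₁ * diagonalParam a b c m n u₀ v₀ d₁ d₂ t)
          (v₀ + d₂ * diagonalParam a b c m n u₀ v₀ d₁ d₂ t) +
      (d₂ * (diagonalSpeed a b c m n u₀ v₀ d₁ d₂ (diagonalParam a b c m n u₀ v₀ d₁ d₂ t))⁻¹) •
        confocalTangent₂ a b c m n (u₀ + d₁ * diagonalParam a b c m n u₀ v₀ d₁ d₂ t)
          (v₀ + d₂ * diagonalParam a b c m n u₀ v₀ d₁ d₂ t)) t := by
  have h1 := h.hasDerivAt_diagonalParam hd₁ u₀ v₀ d₂ ht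
  exact h.hasDerivAt_confocalMap ((h1.const_mul d₁).const_add u₀) ((h1.const_mul d₂).const_add v₀)

theorem contDiffOn_diagonalLine : ContDiffOn ℝ 1 (diagonalLine a b c m n u₀ v₀ d₁ d₂)
    (regularTimes a b c m n u₀ v₀ d₁ d₂) := by
  have hσ : ContDiffOn ℝ 1 (diagonalParam a b c m n u₀ v₀ d₁ d₂)
      (regularTimes a b c m n u₀ v₀ d₁ d₂) := by
    have ho := h.isOpen_regularTimes hd₁ u₀ v₀ d₂
    rw [contDiffOn_one_iff_derivWithin ho.uniqueDiffOn]
    refine ⟨fun t ht => (h.hasDerivAt_diagonalParam hd₁ u₀ v₀ d₂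
      ht).differentiableAt.differentiableWithinAt, ?_⟩
    have hc : ContinuousOn (fun t => (diagonalSpeed a b c m n u₀ v₀ d₁ d₂
        (diagonalParam a b c m n u₀ v₀ d₁ d₂ t))⁻¹) (regularTimes a b c m n u₀ v₀ d₁ d₂) := by
      refine ContinuousOn.inv₀ ((h.continuous_diagonalSpeed u₀ v₀ d₁ d₂).comp
        (h.continuous_diagonalParam hd₁ u₀ v₀ d₂)).continuousOn fun t ht => ?_
      exact (Real.sqrt_pos.2 (h.diagonalSpeedSq_pos ht)).ne'
    refine hc.congr fun t ht => ?_
    rw [derivWithin_of_isOpen ho ht, (h.hasDerivAt_diagonalParam hd₁ u₀ v₀ d₂ ht).deriv]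
  have h2 : ContDiffOn ℝ 1 (fun t => ((u₀ + d₁ * diagonalParam a b c m n u₀ v₀ d₁ d₂ t,
      v₀ + d₂ * diagonalParam a b c m n u₀ v₀ d₁ d₂ t, 1) : ℝ × ℝ × ℝ))
      (regularTimes a b c m n u₀ v₀ d₁ d₂) :=
    (contDiffOn_const.add (contDiffOn_const.mul hσ)).prodMk
      ((contDiffOn_const.add (contDiffOn_const.mul hσ)).prodMk contDiffOn_const)
  have h3 := h.contDiff_scaled_confocalMap.comp_contDiffOn h2
  refine h3.congr fun t _ => ?_
  simp [diagonalLine]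

end Param

theorem isHarmonicArc_diagonalLine {d₁ d₂ : ℝ} (hd₁ : d₁ ^ 2 = 1) (hd₂ : d₂ ^ 2 = 1)
    (u₀ v₀ t₀ : ℝ) {J : Set ℝ} (hJo : IsOpen J) (hJc : J.OrdConnected) (hJn : J.Nonempty)
    (hJ : ∀ t ∈ J, t - t₀ ∈ regularTimes a b c m n u₀ v₀ d₁ d₂) :
    IsHarmonicArc a b c J fun t => diagonalLine a b c m n u₀ v₀ d₁ d₂ (t - t₀) := by
  have hder : ∀ t ∈ J, HasDerivAt (fun t => diagonalLine a b c m n u₀ v₀ d₁ d₂ (t - t₀)) _ t :=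
    fun t ht => (h.hasDerivAt_diagonalLine hd₁ u₀ v₀ d₂ (hJ t ht)).comp_sub_const t t₀
  have hspeed : ∀ t ∈ J, ‖deriv (fun t => diagonalLine a b c m n u₀ v₀ d₁ d₂ (t - t₀)) t‖ = 1 := by
    intro t ht
    rw [(hder t ht).deriv]
    have hpos := h.diagonalSpeedSq_pos (hJ t ht)
    set u := u₀ + d₁ * diagonalParam a b c m n u₀ v₀ d₁ d₂ (t - t₀) with hu
    set v := v₀ + d₂ * diagonalParam a b c m n u₀ v₀ d₁ d₂ (t - t₀) with hv
    have hs : diagonalSpeed a b c m n u₀ v₀ d₁ d₂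
      (diagonalParam a b c m n u₀ v₀ d₁ d₂ (t - t₀)) ^ 2 = diagonalSpeedSq a b c m n u v :=
      Real.sq_sqrt hpos.le
    rw [← sq_eq_sq₀ (norm_nonneg _) zero_le_one, ← real_inner_self_eq_norm_sq,
      h.normSq_diagonal, mul_pow, mul_pow, hd₁, hd₂, inv_pow, hs, one_pow]
    have h2 : diagonalSpeedSq a b c m n u v = confocalFactor m n u v *
      ((b ^ 2 + (a ^ 2 - b ^ 2) * sinAm n m u ^ 2) +
        (b ^ 2 - (b ^ 2 - c ^ 2) * sinAm m n v ^ 2)) := by rw [diagonalSpeedSq]; ring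
    calc _ = (diagonalSpeedSq a b c m n u v)⁻¹ * diagonalSpeedSq a b c m n u v := by
          conv_rhs => rw [h2]
          rw [h2]; ring
      _ = 1 := inv_mul_cancel₀ hpos.ne'
  refine ⟨hJo, hJc, hJn, ?_, fun t ht => ⟨h.confocalMap_mem_ellipsoid _ _, fun hmem => hJ t ht
    ((h.confocalMap_mem_umbilics_iff _ _).1 hmem)⟩, hspeed, fun t ht => ?_⟩
  · exact (h.contDiffOn_diagonalLine hd₁ u₀ v₀ d₂).comp
      (contDiff_id.sub contDiff_const).contDiffOn hJ
  · have hne : deriv (fun t => diagonalLine a b c m n u₀ v₀ d₁ d₂ (t - t₀)) t ≠ 0 :=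
      norm_ne_zero_iff.1 (by rw [hspeed t ht]; exact one_ne_zero)
    rw [(hder t ht).deriv] at hne ⊢
    exact (h.normalCurvature_confocal_iff (hJ t ht) hne).2 (by rw [mul_pow, mul_pow, hd₁, hd₂])

/-! ## Lifting arcs to confocal coordinates -/

/-- For the inner product defined by the ellipsoid, the position and the two coordinate tangents are
pairwise orthogonal, of square norms `1`, `W` and `W`, where `W` is the conformal factor. -/
theorem tangent_eq_zero {u v α β r : ℝ} (hW : confocalFactor m n u v ≠ 0)
    (h0 : r • confocalMap a b c m n u v + (α • confocalTangent₁ a b c m n u v +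
      β • confocalTangent₂ a b c m n u v) = 0) : α = 0 ∧ β = 0 ∧ r = 0 := by
  have e0 := h.ellipsoidForm_confocalMap u v
  rw [← inner_ellipsoidOp_self] at e0
  have e1 := h.inner_normal_tangent₁ u v
  have e2 := h.inner_normal_tangent₂ u v
  have e3 := h.inner_ellipsoidOp_tangent₁_tangent₂ u v
  have e4 := h.form_tangent₁ u v
  have e5 := h.form_tangent₂ u v
  have e1' := inner_ellipsoidOp_comm (a := a) (b := b) (c := c)
    (confocalTangent₁ a b c m n u v) (confocalMap a b c m n u v)
  have e2' := inner_ellipsoidOp_comm (a := a) (b := b) (c := c)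
    (confocalTangent₂ a b c m n u v) (confocalMap a b c m n u v)
  have e3' := inner_ellipsoidOp_comm (a := a) (b := b) (c := c)
    (confocalTangent₂ a b c m n u v) (confocalTangent₁ a b c m n u v)
  rw [e1] at e1'; rw [e2] at e2'; rw [e3] at e3'
  have f0 := congrArg (fun w => ⟪ellipsoidOp a b c (confocalMap a b c m n u v), w⟫) h0
  have f1 := congrArg (fun w => ⟪ellipsoidOp a b c (confocalTangent₁ a b c m n u v), w⟫) h0
  have f2 := congrArg (fun w => ⟪ellipsoidOp a b c (confocalTangent₂ a b c m n u v), w⟫) h0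
  simp only [inner_add_right, real_inner_smul_right, inner_zero_right, e0, e1, e2, e3, e4, e5,
    e1', e2', e3', mul_zero, mul_one, add_zero, zero_add] at f0 f1 f2
  exact ⟨(mul_eq_zero.1 f1).resolve_right hW, (mul_eq_zero.1 f2).resolve_right hW, f0⟩

/-- Invert the cone map `(u, v, r) ↦ r • confocalMap`, whose derivative is injective off the umbilic
points. On the ellipsoid `r² = 1`, and `r` is positive near `t₁`, hence `r = 1`. -/
theorem exists_lift {δ : ℝ → E3} {t₁ u₁ v₁ : ℝ} (hδ : ContDiffAt ℝ 1 δ t₁)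
    (hE : ∀ᶠ t in 𝓝 t₁, δ t ∈ ellipsoid a b c) (hW : confocalFactor m n u₁ v₁ ≠ 0)
    (h1 : confocalMap a b c m n u₁ v₁ = δ t₁) :
    ∃ u v : ℝ → ℝ, ContDiffAt ℝ 1 u t₁ ∧ ContDiffAt ℝ 1 v t₁ ∧ u t₁ = u₁ ∧ v t₁ = v₁ ∧
      ∀ᶠ t in 𝓝 t₁, δ t = confocalMap a b c m n (u t) (v t) := by
  set Φ : ℝ × ℝ × ℝ → E3 := fun q => q.2.2 • confocalMap a b c m n q.1 q.2.1 with hΦ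
  have hC : ContDiff ℝ 1 Φ := h.contDiff_scaled_confocalMap
  set q₁ : ℝ × ℝ × ℝ := (u₁, v₁, 1) with hq₁
  have hD : HasFDerivAt Φ (fderiv ℝ Φ q₁) q₁ := (hC.differentiable one_ne_zero q₁).hasFDerivAt
  have hval : ∀ w : ℝ × ℝ × ℝ, fderiv ℝ Φ q₁ w = w.2.2 • confocalMap a b c m n u₁ v₁ +
      (w.1 • confocalTangent₁ a b c m n u₁ v₁ + w.2.1 • confocalTangent₂ a b c m n u₁ v₁) := by
    intro w
    have l1 : ∀ x y : ℝ, HasDerivAt (fun s => x + s * y) y 0 := fun x y => by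
      simpa using ((hasDerivAt_id (0 : ℝ)).mul_const y).const_add x
    have g1 : HasDerivAt (fun s : ℝ => ((u₁ + s * w.1, v₁ + s * w.2.1, 1 + s * w.2.2) : ℝ × ℝ × ℝ))
      w 0 := (l1 u₁ w.1).prodMk ((l1 v₁ w.2.1).prodMk (l1 1 w.2.2))
    have hD' : HasFDerivAt Φ (fderiv ℝ Φ q₁) (u₁ + 0 * w.1, v₁ + 0 * w.2.1, 1 + 0 * w.2.2) := by
      simpa [hq₁] using hD
    have g2 := hD'.comp_hasDerivAt (0 : ℝ) g1
    have g3 := (l1 1 w.2.2).smul (h.hasDerivAt_confocalMap (l1 u₁ w.1) (l1 v₁ w.2.1))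
    have := g2.unique g3
    rw [this]
    simp only [zero_mul, add_zero, one_smul]
    exact add_comm _ _
  have hinj : Function.Injective (fderiv ℝ Φ q₁ : ℝ × ℝ × ℝ →ₗ[ℝ] E3) := by
    rw [← LinearMap.ker_eq_bot, LinearMap.ker_eq_bot']
    intro w hw
    have := h.tangent_eq_zero hW ((hval w).symm.trans hw)
    exact Prod.ext this.1 (Prod.ext this.2.1 this.2.2)
  let L : (ℝ × ℝ × ℝ) ≃L[ℝ] E3 := (LinearMap.linearEquivOfInjective
    (fderiv ℝ Φ q₁ : ℝ × ℝ × ℝ →ₗ[ℝ] E3) hinj (by simp [E3])).toContinuousLinearEquiv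
  have hL : HasFDerivAt Φ (L : ℝ × ℝ × ℝ →L[ℝ] E3) q₁ := by
    convert! hD using 1
  have hC' : ContDiffAt ℝ 1 Φ q₁ := hC.contDiffAt
  have hΦq : Φ q₁ = δ t₁ := by simp [hΦ, hq₁, h1]
  set g := hC'.localInverse hL one_ne_zero with hg
  have hgC : ContDiffAt ℝ 1 g (δ t₁) := hΦq ▸ hC'.to_localInverse hL one_ne_zero
  have hgq : g (δ t₁) = q₁ := hΦq ▸ hC'.localInverse_apply_image hL one_ne_zero
  have hright : ∀ᶠ y in 𝓝 (δ t₁), Φ (g y) = y :=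
    hΦq ▸ (hC'.hasStrictFDerivAt' hL one_ne_zero).eventually_right_inverse
  have hgδ : ContDiffAt ℝ 1 (fun t => g (δ t)) t₁ := hgC.comp t₁ hδ
  refine ⟨fun t => (g (δ t)).1, fun t => (g (δ t)).2.1, hgδ.fst, hgδ.snd.fst, by simp [hgq, hq₁],
    by simp [hgq, hq₁], ?_⟩
  have hpos : ∀ᶠ t in 𝓝 t₁, 0 < (g (δ t)).2.2 :=
    hgδ.snd.snd.continuousAt.eventually (lt_mem_nhds (by simp [hgq, hq₁]))
  filter_upwards [hpos, hE, hδ.continuousAt.eventually hright] with t h2 h3 h4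
  have h5 : ((g (δ t)).2.2) ^ 2 = 1 := by
    have h6 : ellipsoidForm a b c (δ t) = 1 := h3
    rw [← h4, ← inner_ellipsoidOp_self, hΦ] at h6
    simp only [map_smul, real_inner_smul_left, real_inner_smul_right] at h6
    rw [inner_ellipsoidOp_self, h.ellipsoidForm_confocalMap] at h6
    linarith
  have h6 : (g (δ t)).2.2 = 1 := by nlinarith
  simp only [hΦ, h6, one_smul] at h4
  exact h4.symm

end ConfocalModuli

end

/-! ### Local uniqueness and continuation of harmonic mean curvature lines -/

noncomputable section

theorem ContDiffAt.continuousAt_deriv_of_one {E : Type*} [NormedAddCommGroup E] [NormedSpace ℝ E]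
    {f : ℝ → E} {x : ℝ} (hf : ContDiffAt ℝ 1 f x) : ContinuousAt (deriv f) x :=
  (hf.continuousAt_fderiv one_ne_zero).clm_apply continuousAt_const

theorem isOpen_ordConnectedComponent {s : Set ℝ} (hs : IsOpen s) (x : ℝ) :
    IsOpen (ordConnectedComponent s x) := by
  refine isOpen_iff_mem_nhds.2 fun y hy => ?_
  rw [ordConnectedComponent_eq hy, ordConnectedComponent_mem_nhds]
  exact hs.mem_nhds (hy right_mem_uIcc)

theorem exists_sign_mul_pos {x : ℝ} (hx : x ≠ 0) : ∃ d : ℝ, d ^ 2 = 1 ∧ 0 < d * x := by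
  rcases hx.lt_or_gt with h | h
  · exact ⟨-1, by norm_num, by linarith⟩
  · exact ⟨1, by norm_num, by linarith⟩

namespace IsHarmonicArc

variable {a b c : ℝ} {I : Set ℝ} {γ : ℝ → E3}

theorem contDiffAt (hγ : IsHarmonicArc a b c I γ) {t : ℝ} (ht : t ∈ I) : ContDiffAt ℝ 1 γ t :=
  hγ.contDiffOn.contDiffAt (hγ.isOpen.mem_nhds ht)

end IsHarmonicArc

namespace ConfocalModuli

variable {a b c m n : ℝ} (h : ConfocalModuli a b c m n)
include h

/-- Locally, a harmonic mean curvature line is a diagonal line. -/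
theorem eventuallyEq_diagonalLine {I : Set ℝ} {γ : ℝ → E3} (hγ : IsHarmonicArc a b c I γ)
    {t₁ : ℝ} (ht₁ : t₁ ∈ I) {u₁ v₁ : ℝ} (h1 : confocalMap a b c m n u₁ v₁ = γ t₁) :
    ∃ d₁ d₂ : ℝ, d₁ ^ 2 = 1 ∧ d₂ ^ 2 = 1 ∧
      γ =ᶠ[𝓝 t₁] fun t => diagonalLine a b c m n u₁ v₁ d₁ d₂ (t - t₁) := by
  have hIn : ∀ᶠ t in 𝓝 t₁, t ∈ I := hγ.isOpen.mem_nhds ht₁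
  have hW : confocalFactor m n u₁ v₁ ≠ 0 := fun h0 =>
    (hγ.mem t₁ ht₁).2 (h1 ▸ (h.confocalMap_mem_umbilics_iff u₁ v₁).2 h0)
  obtain ⟨u, v, hu, hv, hu1, hv1, hlift⟩ := h.exists_lift (hγ.contDiffAt ht₁)
    (hIn.mono fun t ht => (hγ.mem t ht).1) hW h1
  have hdiff : ∀ᶠ t in 𝓝 t₁, HasDerivAt u (deriv u t) t ∧ HasDerivAt v (deriv v t) t := by
    filter_upwards [hu.eventually (by simp), hv.eventually (by simp)] with t h2 h3
    exact ⟨(h2.differentiableAt one_ne_zero).hasDerivAt,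
      (h3.differentiableAt one_ne_zero).hasDerivAt⟩
  -- the two differential equations
  have hode : ∀ᶠ t in 𝓝 t₁, deriv u t ^ 2 = deriv v t ^ 2 ∧
      deriv u t ^ 2 * diagonalSpeedSq a b c m n (u t) (v t) = 1 := by
    filter_upwards [hIn, hdiff, hlift.eventually_nhds] with t hI hd hl
    have hval := hl.self_of_nhds
    have hder : deriv γ t = deriv u t • confocalTangent₁ a b c m n (u t) (v t) +
        deriv v t • confocalTangent₂ a b c m n (u t) (v t) :=
      ((h.hasDerivAt_confocalMap hd.1 hd.2).congr_of_eventuallyEq hl).deriv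
    have hWt : confocalFactor m n (u t) (v t) ≠ 0 := fun h0 =>
      (hγ.mem t hI).2 (hval ▸ (h.confocalMap_mem_umbilics_iff _ _).2 h0)
    have hsp := hγ.speed t hI
    have hne : deriv γ t ≠ 0 := norm_ne_zero_iff.1 (by rw [hsp]; exact one_ne_zero)
    have hh := hγ.harmonic t hI
    rw [hder] at hne hsp hh
    rw [hval, h.normalCurvature_confocal_iff hWt hne] at hh
    refine ⟨hh, ?_⟩
    have hn := h.normSq_diagonal (α := deriv u t) (β := deriv v t) (u t) (v t)
    rw [real_inner_self_eq_norm_sq, hsp, ← hh] at hn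
    rw [diagonalSpeedSq]
    linarith
  have hode1 := hode.self_of_nhds
  have hu0 : deriv u t₁ ≠ 0 := fun h0 => by
    have := hode1.2; rw [h0] at this; norm_num at this
  have hv0 : deriv v t₁ ≠ 0 := fun h0 => hu0 (by
    have := hode1.1; rw [h0] at this; simpa using this)
  -- Since the lift is `C¹` and its derivatives do not vanish, their signs are constant near `t₁`;
  -- these signs are the slopes.
  obtain ⟨d₁, hd₁, hp₁⟩ := exists_sign_mul_pos hu0
  obtain ⟨d₂, hd₂, hp₂⟩ := exists_sign_mul_pos hv0
  have hpos₁ : ∀ᶠ t in 𝓝 t₁, 0 < d₁ * deriv u t :=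
    (continuousAt_const.mul hu.continuousAt_deriv_of_one).eventually (lt_mem_nhds hp₁)
  have hpos₂ : ∀ᶠ t in 𝓝 t₁, 0 < d₂ * deriv v t :=
    (continuousAt_const.mul hv.continuousAt_deriv_of_one).eventually (lt_mem_nhds hp₂)
  refine ⟨d₁, d₂, hd₁, hd₂, ?_⟩
  obtain ⟨ε, hε, hball⟩ := Metric.eventually_nhds_iff_ball.1
    (hdiff.and (hode.and (hpos₁.and (hpos₂.and hlift))))
  have hmem : t₁ ∈ Metric.ball t₁ ε := Metric.mem_ball_self hε
  have hpre : IsPreconnected (Metric.ball t₁ ε) := (convex_ball t₁ ε).isPreconnected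
  have hs₁ : ∀ t ∈ Metric.ball t₁ ε, HasDerivAt (fun t => d₁ * (u t - u₁)) (d₁ * deriv u t) t :=
    fun t ht => ((hball t ht).1.1.sub_const u₁).const_mul d₁
  have hs₂ : ∀ t ∈ Metric.ball t₁ ε, HasDerivAt (fun t => d₂ * (v t - v₁)) (d₂ * deriv v t) t :=
    fun t ht => ((hball t ht).1.2.sub_const v₁).const_mul d₂
  -- Both sides have the same positive derivative and vanish at `t₁`; their common value is the
  -- parameter along the diagonal.
  have heq : EqOn (fun t => d₁ * (u t - u₁)) (fun t => d₂ * (v t - v₁)) (Metric.ball t₁ ε) := by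
    refine Metric.isOpen_ball.eqOn_of_deriv_eq hpre
      (fun t ht => (hs₁ t ht).differentiableAt.differentiableWithinAt)
      (fun t ht => (hs₂ t ht).differentiableAt.differentiableWithinAt) (fun t ht => ?_) hmem
      (by simp [hu1, hv1])
    rw [(hs₁ t ht).deriv, (hs₂ t ht).deriv]
    obtain ⟨-, ho, hq₁, hq₂, -⟩ := hball t ht
    refine (sq_eq_sq₀ hq₁.le hq₂.le).1 ?_
    rw [mul_pow, mul_pow, hd₁, hd₂, ho.1]
  have huv : ∀ t ∈ Metric.ball t₁ ε, u t = u₁ + d₁ * (d₁ * (u t - u₁)) ∧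
      v t = v₁ + d₂ * (d₁ * (u t - u₁)) := by
    intro t ht
    have := heq ht
    simp only at this
    exact ⟨by linear_combination (u₁ - u t) * hd₁,
      by rw [this]; linear_combination (v₁ - v t) * hd₂⟩
  -- the length along the line is the time
  have hlen : EqOn (fun t => diagonalLength a b c m n u₁ v₁ d₁ d₂ (d₁ * (u t - u₁)))
      (fun t => t - t₁) (Metric.ball t₁ ε) := by
    have hL : ∀ t ∈ Metric.ball t₁ ε, HasDerivAt
        (fun t => diagonalLength a b c m n u₁ v₁ d₁ d₂ (d₁ * (u t - u₁))) 1 t := by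
      intro t ht
      have hc := h.continuous_diagonalSpeed u₁ v₁ d₁ d₂
      have g1 : HasDerivAt (diagonalLength a b c m n u₁ v₁ d₁ d₂) _ (d₁ * (u t - u₁)) :=
        intervalIntegral.integral_hasDerivAt_right (hc.intervalIntegrable 0 _)
          (hc.stronglyMeasurableAtFilter _ _) hc.continuousAt
      have g2 := g1.comp t (hs₁ t ht)
      convert! g2 using 1
      obtain ⟨-, ho, hq₁, -, -⟩ := hball t ht
      rw [diagonalSpeed, ← (huv t ht).1, ← (huv t ht).2]
      have hsq : (√(diagonalSpeedSq a b c m n (u t) (v t)) * (d₁ * deriv u t)) ^ 2 = 1 := by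
        rw [mul_pow, mul_pow, hd₁, Real.sq_sqrt (h.diagonalSpeedSq_nonneg _ _)]
        linarith [ho.2]
      have hnn : 0 ≤ √(diagonalSpeedSq a b c m n (u t) (v t)) * (d₁ * deriv u t) :=
        mul_nonneg (Real.sqrt_nonneg _) hq₁.le
      exact ((pow_eq_one_iff_of_nonneg hnn two_ne_zero).1 hsq).symm
    refine Metric.isOpen_ball.eqOn_of_deriv_eq hpre
      (fun t ht => (hL t ht).differentiableAt.differentiableWithinAt)
      (fun t ht => (differentiableAt_id.sub_const t₁).differentiableWithinAt)
      (fun t ht => ?_) hmem (by simp [hu1, diagonalLength])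
    rw [(hL t ht).deriv]
    exact ((hasDerivAt_id t).sub_const t₁).deriv.symm
  filter_upwards [Metric.ball_mem_nhds t₁ hε] with t ht
  have e1 := hlen ht
  simp only at e1
  have e2 := h.diagonalParam_diagonalLength hd₁ u₁ v₁ d₂ (d₁ * (u t - u₁))
  rw [e1] at e2
  rw [(hball t ht).2.2.2.2, diagonalLine, e2, ← (huv t ht).1, ← (huv t ht).2]

/-- A harmonic arc is determined near a point by its velocity. -/
theorem eventuallyEq_of_deriv_eq {I J : Set ℝ} {γ δ : ℝ → E3} (hγ : IsHarmonicArc a b c I γ)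
    (hδ : IsHarmonicArc a b c J δ) {t₁ : ℝ} (htI : t₁ ∈ I) (htJ : t₁ ∈ J) (h0 : γ t₁ = δ t₁)
    (h1 : deriv γ t₁ = deriv δ t₁) : γ =ᶠ[𝓝 t₁] δ := by
  obtain ⟨u₁, v₁, huv⟩ := h.exists_confocalMap_eq (hγ.mem t₁ htI).1
  obtain ⟨d₁, d₂, hd₁, hd₂, hg⟩ := h.eventuallyEq_diagonalLine hγ htI huv
  obtain ⟨d₁', d₂', hd₁', hd₂', hg'⟩ := h.eventuallyEq_diagonalLine hδ htJ (huv.trans h0)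
  have hW : confocalFactor m n u₁ v₁ ≠ 0 := fun h0 =>
    (hγ.mem t₁ htI).2 (huv ▸ (h.confocalMap_mem_umbilics_iff u₁ v₁).2 h0)
  have key : ∀ {e₁ e₂ : ℝ} {η : ℝ → E3}, e₁ ^ 2 = 1 →
      η =ᶠ[𝓝 t₁] (fun t => diagonalLine a b c m n u₁ v₁ e₁ e₂ (t - t₁)) →
      deriv η t₁ = (e₁ * (√(diagonalSpeedSq a b c m n u₁ v₁))⁻¹) •
        confocalTangent₁ a b c m n u₁ v₁ + (e₂ * (√(diagonalSpeedSq a b c m n u₁ v₁))⁻¹) •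
        confocalTangent₂ a b c m n u₁ v₁ := by
    intro e₁ e₂ η he hη
    have hz := h.diagonalParam_zero he u₁ v₁ e₂
    have hr : t₁ - t₁ ∈ regularTimes a b c m n u₁ v₁ e₁ e₂ := by
      simpa [regularTimes, hz] using hW
    have := ((h.hasDerivAt_diagonalLine he u₁ v₁ e₂ hr).comp_sub_const t₁
      t₁).congr_of_eventuallyEq hη
    rw [this.deriv, sub_self, hz]
    simp [diagonalSpeed]
  rw [key hd₁ hg, key hd₁' hg'] at h1
  have hs : (√(diagonalSpeedSq a b c m n u₁ v₁))⁻¹ ≠ 0 :=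
    inv_ne_zero (Real.sqrt_pos.2 (h.diagonalSpeedSq_pos hW)).ne'
  obtain ⟨k1, k2, -⟩ := h.tangent_eq_zero (r := 0) (α := (d₁ - d₁') *
    (√(diagonalSpeedSq a b c m n u₁ v₁))⁻¹) (β := (d₂ - d₂') *
    (√(diagonalSpeedSq a b c m n u₁ v₁))⁻¹) hW (by
      rw [← sub_eq_zero] at h1
      rw [← h1]
      module)
  have e1 : d₁ = d₁' := sub_eq_zero.1 ((mul_eq_zero.1 k1).resolve_right hs)
  have e2 : d₂ = d₂' := sub_eq_zero.1 ((mul_eq_zero.1 k2).resolve_right hs)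
  subst e1 e2
  exact hg.trans hg'.symm

/-- Every harmonic mean curvature line is a maximal regular arc of a diagonal line. -/
theorem exists_eqOn_diagonalLine {I : Set ℝ} {γ : ℝ → E3} (hγ : IsHarmonicLine a b c I γ) :
    ∃ u₀ v₀ d₁ d₂ t₀ : ℝ, d₁ ^ 2 = 1 ∧ d₂ ^ 2 = 1 ∧
      (0 : ℝ) ∈ regularTimes a b c m n u₀ v₀ d₁ d₂ ∧
      I = ordConnectedComponent ((fun t => t - t₀) ⁻¹' regularTimes a b c m n u₀ v₀ d₁ d₂) t₀ ∧
      EqOn γ (fun t => diagonalLine a b c m n u₀ v₀ d₁ d₂ (t - t₀)) I := by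
  have hA := hγ.toIsHarmonicArc
  obtain ⟨t₀, ht₀⟩ := hA.nonempty
  obtain ⟨u₀, v₀, huv⟩ := h.exists_confocalMap_eq (hA.mem t₀ ht₀).1
  obtain ⟨d₁, d₂, hd₁, hd₂, hg⟩ := h.eventuallyEq_diagonalLine hA ht₀ huv
  set δ : ℝ → E3 := fun t => diagonalLine a b c m n u₀ v₀ d₁ d₂ (t - t₀) with hδ
  set N : Set ℝ := (fun t => t - t₀) ⁻¹' regularTimes a b c m n u₀ v₀ d₁ d₂ with hN
  have hNo : IsOpen N :=
    (h.isOpen_regularTimes hd₁ u₀ v₀ d₂).preimage (continuous_id.sub continuous_const)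
  have hδc : Continuous δ :=
    (h.continuous_diagonalLine hd₁ u₀ v₀ d₂).comp (continuous_id.sub continuous_const)
  have hmemN : ∀ t ∈ I, γ t = δ t → t ∈ N := fun t ht heq h0 =>
    (hA.mem t ht).2 (heq ▸ (h.confocalMap_mem_umbilics_iff _ _).2 h0)
  have harc : ∀ t ∈ N, IsHarmonicArc a b c (ordConnectedComponent N t) δ := fun t ht =>
    h.isHarmonicArc_diagonalLine hd₁ hd₂ u₀ v₀ t₀ (isOpen_ordConnectedComponent hNo t)
      inferInstance (nonempty_ordConnectedComponent.2 ht)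
      fun s hs => ordConnectedComponent_subset (s := N) hs
  -- Continuation by connectedness: the points near which the two curves agree form an open,
  -- relatively closed subset of `I`.
  have hsub : I ⊆ I ∩ {t | γ =ᶠ[𝓝 t] δ} := by
    refine hA.ordConnected.isPreconnected.subset_of_closure_inter_subset
      (hA.isOpen.inter isOpen_setOfPred_eventually_nhds) ⟨t₀, ht₀, ht₀, hg⟩ ?_
    rintro t ⟨hcl, htI⟩
    have hfr := mem_closure_iff_frequently.1 hcl
    have hγc := (hA.contDiffAt htI)
    have heq : γ t = δ t := by
      refine tendsto_nhds_unique_of_frequently_eq hγc.continuousAt hδc.continuousAt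
        (hfr.mono fun s hs => ?_)
      exact hs.2.self_of_nhds
    have htN := hmemN t htI heq
    have hself := self_mem_ordConnectedComponent.2 htN
    -- Agreement of values would not suffice, as several diagonals pass through each point; the
    -- velocities agree as well, by continuity of the derivatives.
    refine ⟨htI, h.eventuallyEq_of_deriv_eq hA (harc t htN) htI hself heq ?_⟩
    refine tendsto_nhds_unique_of_frequently_eq hγc.continuousAt_deriv_of_one
      ((harc t htN).contDiffAt hself).continuousAt_deriv_of_one (hfr.mono fun s hs => ?_)
    exact hs.2.deriv_eq
  have hEq : EqOn γ δ I := fun t ht => (hsub ht).2.self_of_nhds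
  have hIN : I ⊆ N := fun t ht => hmemN t ht (hEq ht)
  have ht₀N := hIN ht₀
  have := hA.ordConnected
  refine ⟨u₀, v₀, d₁, d₂, t₀, hd₁, hd₂, by simpa [hN] using ht₀N, ?_, hEq⟩
  exact (hγ.maximal _ δ (harc t₀ ht₀N) (subset_ordConnectedComponent ht₀ hIN) hEq).symm

end ConfocalModuli

end

noncomputable section

/-! ## Recurrence and closedness -/

/-- Dirichlet approximation is applied to `M * p` instead of `p`, so that the multiple found is at
least `M`. No irrationality is needed. -/
theorem exists_nat_mul_sub_int_mul_lt {p T ε : ℝ} (hT : 0 < T) (hε : 0 < ε) (M : ℕ) :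
    ∃ k : ℕ, M ≤ k ∧ ∃ l : ℤ, |k * p - l * T| < ε := by
  have : Fact (0 < T) := ⟨hT⟩
  obtain ⟨N, hN⟩ := exists_nat_gt (T / ε)
  have hN0 : 0 < N := by
    have : (0 : ℝ) < N := (div_pos hT hε).trans hN
    exact_mod_cast this
  obtain ⟨j, hj, hle⟩ := AddCircle.exists_norm_nsmul_le (T := T)
    (((M : ℝ) * p : ℝ) : AddCircle T) hN0
  by_cases hM : M = 0
  · exact ⟨0, by omega, 0, by simpa using hε⟩
  refine ⟨j * M, Nat.le_mul_of_pos_left M (by have := hj.1; omega),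
    round (T⁻¹ * (j * (M * p))), ?_⟩
  rw [← AddCircle.coe_nsmul, AddCircle.norm_eq, nsmul_eq_mul] at hle
  push_cast
  rw [mul_assoc]
  refine hle.trans_lt ?_
  rw [div_lt_iff₀ (by positivity)]
  rw [div_lt_iff₀ hε] at hN
  push_cast
  linarith

/-- A nonzero `x` would make `p / q` equal to `j / i` or `-j / i`. -/
theorem eq_zero_of_irrational_div {p q d₁ d₂ x r : ℝ} {i j : ℤ} (hirr : Irrational (p / q))
    (hd₁ : d₁ ^ 2 = 1) (hd₂ : d₂ ^ 2 = 1) (hi : d₁ * x = i * (r * p)) (hj : d₂ * x = j * (r * q)) :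
    x = 0 := by
  by_contra hx
  have hne : ∀ {d : ℝ}, d ^ 2 = 1 → d ≠ 0 := fun hd h0 => by rw [h0] at hd; norm_num at hd
  have hi0 := mul_ne_zero (hne hd₁) hx
  have hj0 := mul_ne_zero (hne hd₂) hx
  rw [hi] at hi0
  rw [hj] at hj0
  have hi' : (i : ℝ) ≠ 0 := left_ne_zero_of_mul hi0
  have hr : r ≠ 0 := left_ne_zero_of_mul (right_ne_zero_of_mul hi0)
  have hq : q ≠ 0 := right_ne_zero_of_mul (right_ne_zero_of_mul hj0)
  rcases sq_eq_sq_iff_eq_or_eq_neg.1 (hd₁.trans hd₂.symm) with h | h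
  · refine hirr ⟨(j / i : ℚ), ?_⟩
    push_cast
    rw [div_eq_div_iff hi' hq]
    rw [h, hj] at hi
    exact mul_left_cancel₀ hr (by linarith)
  · refine hirr ⟨(-j / i : ℚ), ?_⟩
    push_cast
    rw [div_eq_div_iff hi' hq]
    rw [h, neg_mul, hj] at hi
    exact mul_left_cancel₀ hr (by linarith)

/-- A component is relatively closed in `N`, so a finite end, which the open component cannot
contain, lies outside `N`. -/
theorem exists_isLUB_or_isGLB_of_ordConnectedComponent_ne_univ {N : Set ℝ} (hN : IsOpen N) {t₀ : ℝ}
    (ht₀ : t₀ ∈ N) (hne : ordConnectedComponent N t₀ ≠ univ) :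
    (∃ T ∉ N, IsLUB (ordConnectedComponent N t₀) T) ∨
      ∃ T ∉ N, IsGLB (ordConnectedComponent N t₀) T := by
  set I := ordConnectedComponent N t₀ with hI
  have hself : t₀ ∈ I := self_mem_ordConnectedComponent.2 ht₀
  have hoc : I.OrdConnected := inferInstance
  have hopen : IsOpen I := isOpen_ordConnectedComponent hN t₀
  have hclosed : ∀ T ∈ closure I, T ∉ I → T ∉ N := by
    intro T hcl hT hTN
    obtain ⟨x, hx, hxI⟩ := mem_closure_iff_nhds.1 hcl _
      (ordConnectedComponent_mem_nhds.2 (hN.mem_nhds hTN))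
    exact hT (mem_ordConnectedComponent_trans hxI (mem_ordConnectedComponent_comm.1 hx))
  obtain ⟨t₁, ht₁⟩ := (ne_univ_iff_exists_notMem I).1 hne
  rcases le_total t₀ t₁ with hle | hle
  · have hbdd : BddAbove I := ⟨t₁, fun x hx => by
      by_contra hlt; push Not at hlt
      exact ht₁ (hoc.out hself hx ⟨hle, hlt.le⟩)⟩
    have hlub := isLUB_csSup ⟨t₀, hself⟩ hbdd
    refine Or.inl ⟨sSup I, hclosed _ (hlub.mem_closure ⟨t₀, hself⟩) fun hmem => ?_, hlub⟩
    obtain ⟨ε, hε, hball⟩ := Metric.isOpen_iff.1 hopen _ hmem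
    have := hlub.1 (hball (show sSup I + ε / 2 ∈ _ by
      rw [Metric.mem_ball, Real.dist_eq, add_sub_cancel_left, abs_of_pos] <;> linarith))
    linarith
  · have hbdd : BddBelow I := ⟨t₁, fun x hx => by
      by_contra hlt; push Not at hlt
      exact ht₁ (hoc.out hx hself ⟨hlt.le, hle⟩)⟩
    have hglb := isGLB_csInf ⟨t₀, hself⟩ hbdd
    refine Or.inr ⟨sInf I, hclosed _ (hglb.mem_closure ⟨t₀, hself⟩) fun hmem => ?_, hglb⟩
    obtain ⟨ε, hε, hball⟩ := Metric.isOpen_iff.1 hopen _ hmem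
    have := hglb.1 (hball (show sInf I - ε / 2 ∈ _ by
      rw [Metric.mem_ball, Real.dist_eq, sub_sub_cancel_left, abs_neg, abs_of_pos] <;> linarith))
    linarith

/-- Along multiples of the period the curve stays at `γ 0`, so a limit at either end would be this
non-umbilic point. -/
theorem not_isUmbilicSeparatrix_of_isClosedLine {a b c : ℝ} {I : Set ℝ} {γ : ℝ → E3}
    (hγ : IsHarmonicArc a b c I γ) (hcl : IsClosedLine I γ) : ¬ IsUmbilicSeparatrix a b c I γ := by
  obtain ⟨rfl, T, hT, hper⟩ := hcl
  rintro ⟨p, hp, hlim⟩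
  have h0 : γ 0 ∉ umbilics a b c := (hγ.mem 0 (mem_univ 0)).2
  suffices γ 0 = p from h0 (this ▸ hp)
  rcases hlim with hlim | hlim
  · have h1 : Tendsto (fun j : ℕ => (⟨j * T, mem_univ _⟩ : (univ : Set ℝ))) atTop atTop := by
      refine tendsto_atTop.2 fun x => ?_
      filter_upwards [(tendsto_natCast_atTop_atTop.atTop_mul_const hT).eventually_ge_atTop x.1]
        with j hj using hj
    refine tendsto_nhds_unique (tendsto_const_nhds.congr fun j => ?_) (hlim.comp h1)
    exact (hper.nat_mul_eq j).symm
  · have h1 : Tendsto (fun j : ℕ => (⟨-(j * T), mem_univ _⟩ : (univ : Set ℝ))) atTop atBot := by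
      refine tendsto_atBot.2 fun x => ?_
      filter_upwards [(tendsto_natCast_atTop_atTop.atTop_mul_const hT).eventually_ge_atTop (-x.1)]
        with j hj
      exact Subtype.coe_le_coe.1 (by simp only; linarith)
    refine tendsto_nhds_unique (tendsto_const_nhds.congr fun j => ?_) (hlim.comp h1)
    have := hper.neg.nat_mul_eq j
    simpa using this.symm

namespace ConfocalModuli

variable {a b c m n : ℝ} (h : ConfocalModuli a b c m n)
include h

/-- At multiples of the `u`-period the first coordinate returns exactly, and Dirichlet approximation
makes the second return up to `ε`. Negating the integers gives the backward return. -/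
theorem exists_diagonal_return {d₁ d₂ : ℝ} (hd₁ : d₁ ^ 2 = 1) (hd₂ : d₂ ^ 2 = 1) (u v : ℝ)
    {O : Set E3} (hO : O ∈ 𝓝 (confocalMap a b c m n u v)) (M : ℝ) :
    (∃ s ≥ M, confocalMap a b c m n (u + d₁ * s) (v + d₂ * s) ∈ O) ∧
      ∃ s ≤ -M, confocalMap a b c m n (u + d₁ * s) (v + d₂ * s) ∈ O := by
  have hq₂ : 0 < 4 * quarterPeriod n m := by linarith [quarterPeriod_pos h.n_pos h.m_pos]
  have hq₁ : 0 < 4 * quarterPeriod m n := by linarith [quarterPeriod_pos h.m_pos h.n_pos]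
  have hc : ContinuousAt (fun x => confocalMap a b c m n u (v + d₂ * x)) 0 :=
    (h.continuous_confocalMap (u := fun _ => u) (v := fun x => v + d₂ * x)
      (by fun_prop) (by fun_prop)).continuousAt
  have hO' : (fun x => confocalMap a b c m n u (v + d₂ * x)) ⁻¹' O ∈ 𝓝 0 := hc (by simpa using hO)
  obtain ⟨ε, hε, hball⟩ := Metric.mem_nhds_iff.1 hO'
  obtain ⟨M', hM'⟩ := exists_nat_ge (M / (4 * quarterPeriod n m))
  obtain ⟨k, hk, l, hl⟩ := exists_nat_mul_sub_int_mul_lt (p := 4 * quarterPeriod n m) hq₁ hε M'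
  have hMk : M ≤ k * (4 * quarterPeriod n m) := by
    rw [div_le_iff₀ hq₂] at hM'
    have : (M' : ℝ) ≤ k := by exact_mod_cast hk
    nlinarith
  have hint : ∀ d : ℝ, d ^ 2 = 1 → ∃ z : ℤ, d = z := fun d hd => by
    rcases sq_eq_sq_iff_eq_or_eq_neg.1 (hd.trans (one_pow 2).symm) with rfl | rfl
    · exact ⟨1, by simp⟩
    · exact ⟨-1, by simp⟩
  obtain ⟨z₁, rfl⟩ := hint d₁ hd₁
  obtain ⟨z₂, rfl⟩ := hint d₂ hd₂
  have key : ∀ k' l' : ℤ, |(k' : ℝ) * (4 * quarterPeriod n m) - l' * (4 * quarterPeriod m n)| < ε →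
      confocalMap a b c m n (u + z₁ * (k' * (4 * quarterPeriod n m)))
        (v + z₂ * (k' * (4 * quarterPeriod n m))) ∈ O := by
    intro k' l' hlt
    have := hball (show _ ∈ Metric.ball (0 : ℝ) ε by
      rw [mem_ball_zero_iff, Real.norm_eq_abs]; exact hlt)
    rw [mem_preimage, ← h.confocalMap_add_int_mul _ _ (z₁ * k') (z₂ * l')] at this
    convert! this using 2
    · push_cast; ring
    · push_cast; ring
  refine ⟨⟨_, hMk, by simpa using key k l (by simpa using hl)⟩,
    ⟨_, neg_le_neg hMk, ?_⟩⟩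
  have := key (-k) (-l) (by
    rw [← abs_neg]; push_cast; rw [show -(-(k : ℝ) * (4 * quarterPeriod n m) -
      -(l : ℝ) * (4 * quarterPeriod m n)) = k * (4 * quarterPeriod n m) -
      l * (4 * quarterPeriod m n) by ring]; exact hl)
  convert! this using 2 <;> push_cast <;> ring

/-! ### Dynamics of a single line: recurrence, ends and closedness -/

section Line

variable {u₀ v₀ d₁ d₂ t₀ : ℝ} {I : Set ℝ} {γ : ℝ → E3} (hd₁ : d₁ ^ 2 = 1) (hd₂ : d₂ ^ 2 = 1)
  (hEq : EqOn γ (fun t => diagonalLine a b c m n u₀ v₀ d₁ d₂ (t - t₀)) I)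
include hd₁ hd₂ hEq

theorem isOmegaRecurrent (hI : Ici t₀ ⊆ I) : IsOmegaRecurrent I γ := by
  have : Nonempty I := ⟨⟨t₀, hI self_mem_Ici⟩⟩
  rintro _ ⟨t₁, ht₁, rfl⟩
  rw [omegaLim, mem_ofPred_eq, mapClusterPt_iff_frequently]
  intro O hO
  rw [frequently_atTop]
  rintro ⟨x, hx⟩
  rw [hEq ht₁] at hO
  set s₁ := diagonalParam a b c m n u₀ v₀ d₁ d₂ (t₁ - t₀) with hs₁
  -- The maximum with `0` keeps the return time in the half-line from `t₀`, the part known to lie in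
  -- `I`; the shift by `s₁` counts from the point being approached.
  obtain ⟨s, hs, hmem⟩ := (h.exists_diagonal_return hd₁ hd₂ _ _ hO
    (max 0 (diagonalParam a b c m n u₀ v₀ d₁ d₂ (x - t₀)) - s₁)).1
  have hs' : max 0 (diagonalParam a b c m n u₀ v₀ d₁ d₂ (x - t₀)) ≤ s₁ + s := by linarith
  have hmono := (h.strictMono_diagonalLength hd₁ u₀ v₀ d₂).monotone
  have h1 : 0 ≤ diagonalLength a b c m n u₀ v₀ d₁ d₂ (s₁ + s) := by
    simpa [diagonalLength] using hmono ((le_max_left _ _).trans hs')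
  have h2 : x - t₀ ≤ diagonalLength a b c m n u₀ v₀ d₁ d₂ (s₁ + s) := by
    rw [← h.diagonalLength_diagonalParam hd₁ u₀ v₀ d₂ (x - t₀)]
    exact hmono ((le_max_right _ _).trans hs')
  have hI' : t₀ + diagonalLength a b c m n u₀ v₀ d₁ d₂ (s₁ + s) ∈ I := hI (by simpa using h1)
  refine ⟨⟨_, hI'⟩, Subtype.mk_le_mk.2 (by linarith), ?_⟩
  simp only
  rw [hEq hI']
  simp only [add_sub_cancel_left, diagonalLine]
  rw [h.diagonalParam_diagonalLength hd₁]
  convert! hmem using 2 <;> ring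

theorem isAlphaRecurrent (hI : Iic t₀ ⊆ I) : IsAlphaRecurrent I γ := by
  have : Nonempty I := ⟨⟨t₀, hI self_mem_Iic⟩⟩
  rintro _ ⟨t₁, ht₁, rfl⟩
  rw [alphaLim, mem_ofPred_eq, mapClusterPt_iff_frequently]
  intro O hO
  rw [frequently_atBot]
  rintro ⟨x, hx⟩
  rw [hEq ht₁] at hO
  set s₁ := diagonalParam a b c m n u₀ v₀ d₁ d₂ (t₁ - t₀) with hs₁
  obtain ⟨s, hs, hmem⟩ := (h.exists_diagonal_return hd₁ hd₂ _ _ hO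
    (-(min 0 (diagonalParam a b c m n u₀ v₀ d₁ d₂ (x - t₀)) - s₁))).2
  have hs' : s₁ + s ≤ min 0 (diagonalParam a b c m n u₀ v₀ d₁ d₂ (x - t₀)) := by linarith
  have hmono := (h.strictMono_diagonalLength hd₁ u₀ v₀ d₂).monotone
  have h1 : diagonalLength a b c m n u₀ v₀ d₁ d₂ (s₁ + s) ≤ 0 := by
    simpa [diagonalLength] using hmono (hs'.trans (min_le_left _ _))
  have h2 : diagonalLength a b c m n u₀ v₀ d₁ d₂ (s₁ + s) ≤ x - t₀ := by
    rw [← h.diagonalLength_diagonalParam hd₁ u₀ v₀ d₂ (x - t₀)]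
    exact hmono (hs'.trans (min_le_right _ _))
  have hI' : t₀ + diagonalLength a b c m n u₀ v₀ d₁ d₂ (s₁ + s) ∈ I := hI (by simpa using h1)
  refine ⟨⟨_, hI'⟩, Subtype.mk_le_mk.2 (by linarith), ?_⟩
  simp only
  rw [hEq hI']
  simp only [add_sub_cancel_left, diagonalLine]
  rw [h.diagonalParam_diagonalLength hd₁]
  convert! hmem using 2 <;> ring

omit hd₂ in
-- At a finite end the conformal factor vanishes, and the full diagonal line is continuous across
-- umbilic points, so the curve converges to one there.
theorem eq_univ_of_not_isUmbilicSeparatrix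
    (h0 : (0 : ℝ) ∈ regularTimes a b c m n u₀ v₀ d₁ d₂)
    (hI : I = ordConnectedComponent ((fun t => t - t₀) ⁻¹' regularTimes a b c m n u₀ v₀ d₁ d₂) t₀)
    (hns : ¬ IsUmbilicSeparatrix a b c I γ) : I = univ := by
  by_contra hne
  have hcont : Continuous fun t => diagonalLine a b c m n u₀ v₀ d₁ d₂ (t - t₀) :=
    (h.continuous_diagonalLine hd₁ u₀ v₀ d₂).comp (continuous_id.sub continuous_const)
  have hN := (h.isOpen_regularTimes hd₁ u₀ v₀ d₂).preimage
    (continuous_id.sub (continuous_const (y := t₀)))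
  have humb : ∀ T ∉ (fun t => t - t₀) ⁻¹' regularTimes a b c m n u₀ v₀ d₁ d₂,
      diagonalLine a b c m n u₀ v₀ d₁ d₂ (T - t₀) ∈ umbilics a b c := fun T hT =>
    (h.confocalMap_mem_umbilics_iff _ _).2 (not_not.1 hT)
  have hγ : (fun t : I => γ t) =
      (fun t => diagonalLine a b c m n u₀ v₀ d₁ d₂ (t - t₀)) ∘ (Subtype.val : I → ℝ) :=
    funext fun t => hEq t.2
  rcases exists_isLUB_or_isGLB_of_ordConnectedComponent_ne_univ hN (t₀ := t₀) (by simpa using h0)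
    (hI ▸ hne) with ⟨T, hT, hlub⟩ | ⟨T, hT, hglb⟩
  · refine hns ⟨_, humb T hT, Or.inl ?_⟩
    rw [hγ]
    refine hcont.continuousAt.tendsto.comp
      (tendsto_atTop_isLUB (Subtype.mono_coe I) ?_)
    rw [Subtype.range_coe, hI]; exact hlub
  · refine hns ⟨_, humb T hT, Or.inr ?_⟩
    rw [hγ]
    refine hcont.continuousAt.tendsto.comp
      (tendsto_atBot_isGLB (Subtype.mono_coe I) ?_)
    rw [Subtype.range_coe, hI]; exact hglb

omit hd₂ hEq in
-- Umbilic points sit at half-periods, so two of them on one diagonal would differ by half-periods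
-- in both coordinates and make the ratio rational.
theorem subsingleton_umbilic_times (hd₂ : d₂ ^ 2 = 1)
    (hirr : Irrational (quarterPeriod n m / quarterPeriod m n)) {s s' : ℝ}
    (hs : confocalFactor m n (u₀ + d₁ * s) (v₀ + d₂ * s) = 0)
    (hs' : confocalFactor m n (u₀ + d₁ * s') (v₀ + d₂ * s') = 0) : s = s' := by
  rw [h.confocalFactor_eq_zero_iff, sinAm_eq_zero_iff h.n_pos h.m_pos,
    sinAm_eq_zero_iff h.m_pos h.n_pos] at hs hs'
  obtain ⟨⟨i, hi⟩, ⟨j, hj⟩⟩ := hs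
  obtain ⟨⟨i', hi'⟩, ⟨j', hj'⟩⟩ := hs'
  refine sub_eq_zero.1 (eq_zero_of_irrational_div (i := i - i') (j := j - j') (r := 2) hirr hd₁ hd₂
    ?_ ?_)
  · push_cast; linarith
  · push_cast; linarith

omit hd₂ in
theorem not_isClosedLine_of_irrational (hd₂ : d₂ ^ 2 = 1)
    (hirr : Irrational (quarterPeriod n m / quarterPeriod m n))
    (hI : I = univ → ∀ t, t ∈ regularTimes a b c m n u₀ v₀ d₁ d₂) : ¬ IsClosedLine I γ := by
  rintro ⟨rfl, T, hT, hper⟩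
  have hper0 := hper t₀
  rw [hEq (mem_univ _), hEq (mem_univ _)] at hper0
  simp only [add_sub_cancel_left, sub_self] at hper0
  rw [h.diagonalLine_zero hd₁, diagonalLine] at hper0
  have hs : 0 < diagonalParam a b c m n u₀ v₀ d₁ d₂ T := by
    rw [← h.diagonalParam_zero hd₁ u₀ v₀ d₂]
    exact h.strictMono_diagonalParam hd₁ u₀ v₀ d₂ hT
  set s := diagonalParam a b c m n u₀ v₀ d₁ d₂ T
  rcases h.eq_of_confocalMap_eq hper0 with ⟨i, j, hi, hj⟩ | ⟨i, j, hi, hj⟩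
  · exact hs.ne' (eq_zero_of_irrational_div (i := i) (j := j) (r := 4) hirr hd₁ hd₂
      (by linarith) (by linarith))
  -- If the return is through the involution, the midpoint of the segment is a half-period, hence
  -- umbilic, although the line has no umbilic point.
  · refine hI rfl (diagonalLength a b c m n u₀ v₀ d₁ d₂ (s / 2)) ?_
    rw [h.diagonalParam_diagonalLength hd₁, h.confocalFactor_eq_zero_iff,
      sinAm_eq_zero_iff h.n_pos h.m_pos, sinAm_eq_zero_iff h.m_pos h.n_pos]
    exact ⟨⟨i, by linarith⟩, ⟨j, by linarith⟩⟩

theorem isClosedLine_of_rational {q : ℚ} (hq : quarterPeriod n m / quarterPeriod m n = q)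
    (hI : I = univ) : IsClosedLine I γ := by
  subst hI
  have hq₂ := quarterPeriod_pos h.n_pos h.m_pos
  have hq₁ := quarterPeriod_pos h.m_pos h.n_pos
  have hden : (0 : ℝ) < q.den := by exact_mod_cast q.den_pos
  have hrat : quarterPeriod n m * q.den = quarterPeriod m n * q.num := by
    rw [← Rat.num_div_den q] at hq
    push_cast at hq
    rw [div_eq_div_iff hq₁.ne' hden.ne'] at hq
    linarith
  have hint : ∀ d : ℝ, d ^ 2 = 1 → ∃ z : ℤ, d = z := fun d hd => by
    rcases sq_eq_sq_iff_eq_or_eq_neg.1 (hd.trans (one_pow 2).symm) with rfl | rfl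
    · exact ⟨1, by simp⟩
    · exact ⟨-1, by simp⟩
  -- By `hrat` this is a common multiple of both periods: `q.den` times the first and `q.num` times
  -- the second.
  set L := 4 * quarterPeriod n m * q.den with hL
  have hLpos : 0 < L := by positivity
  have hshift : ∀ s, ∃ i j : ℤ, u₀ + d₁ * (s + L) = u₀ + d₁ * s + i * (4 * quarterPeriod n m) ∧
      v₀ + d₂ * (s + L) = v₀ + d₂ * s + j * (4 * quarterPeriod m n) := by
    obtain ⟨z₁, hz₁⟩ := hint d₁ hd₁
    obtain ⟨z₂, hz₂⟩ := hint d₂ hd₂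
    refine fun s => ⟨z₁ * q.den, z₂ * q.num, ?_, ?_⟩
    · rw [hL, hz₁]; push_cast; ring
    · rw [hL, mul_assoc, hrat, hz₂]; push_cast; ring
  have hspeed : Function.Periodic (diagonalSpeed a b c m n u₀ v₀ d₁ d₂) L := fun s => by
    obtain ⟨i, j, hi, hj⟩ := hshift s
    rw [diagonalSpeed, hi, hj, h.diagonalSpeedSq_add_int_mul, diagonalSpeed]
  have hmap : ∀ s, confocalMap a b c m n (u₀ + d₁ * (s + L)) (v₀ + d₂ * (s + L)) =
      confocalMap a b c m n (u₀ + d₁ * s) (v₀ + d₂ * s) := fun s => by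
    obtain ⟨i, j, hi, hj⟩ := hshift s
    rw [hi, hj, h.confocalMap_add_int_mul]
  set T := diagonalLength a b c m n u₀ v₀ d₁ d₂ L with hT
  have hlen : ∀ s, diagonalLength a b c m n u₀ v₀ d₁ d₂ (s + L) =
      diagonalLength a b c m n u₀ v₀ d₁ d₂ s + T := fun s => by
    have hc := h.continuous_diagonalSpeed u₀ v₀ d₁ d₂
    rw [diagonalLength, ← intervalIntegral.integral_add_adjacent_intervals
      (hc.intervalIntegrable 0 s) (hc.intervalIntegrable s (s + L)),
      hspeed.intervalIntegral_add_eq s 0, zero_add]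
    rfl
  have hparam : ∀ t, diagonalParam a b c m n u₀ v₀ d₁ d₂ (t + T) =
      diagonalParam a b c m n u₀ v₀ d₁ d₂ t + L := fun t => by
    rw [← h.diagonalParam_diagonalLength hd₁ u₀ v₀ d₂ (_ + L), hlen,
      h.diagonalLength_diagonalParam hd₁]
  refine ⟨rfl, T, ?_, fun t => ?_⟩
  · have := h.strictMono_diagonalLength hd₁ u₀ v₀ d₂ hLpos
    simpa [diagonalLength, hT] using this
  · rw [hEq (mem_univ _), hEq (mem_univ _)]
    simp only [diagonalLine]
    rw [show t + T - t₀ = t - t₀ + T by ring, hparam, hmap]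

end Line

/-! ### The period ratio as a quotient of elliptic integrals -/

theorem rho_eq (hm : m = (a ^ 2 - b ^ 2) / (a ^ 2 - c ^ 2))
    (hn : n = (b ^ 2 - c ^ 2) / (a ^ 2 - c ^ 2)) :
    rho a b c = quarterPeriod n m / quarterPeriod m n := by
  have h1 : 0 < a ^ 2 - b ^ 2 := by nlinarith [h.b_pos, h.b_lt_a]
  have h2 : 0 < b ^ 2 - c ^ 2 := by nlinarith [h.c_pos, h.c_lt_b]
  have h3 : 0 < a ^ 2 - c ^ 2 := by linarith
  have hK : 0 < √(a ^ 2 - c ^ 2) := Real.sqrt_pos.2 h3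
  have hK2 : √(a ^ 2 - c ^ 2) ^ 2 = a ^ 2 - c ^ 2 := Real.sq_sqrt h3.le
  have hm' : (a ^ 2 - c ^ 2) * m = a ^ 2 - b ^ 2 := by rw [hm]; field_simp
  have hn' : (a ^ 2 - c ^ 2) * n = b ^ 2 - c ^ 2 := by rw [hn]; field_simp
  have hS₂ : S₂ a b c = 2 / √(a ^ 2 - c ^ 2) * quarterPeriod n m := by
    -- Both substitutions start from the common endpoint `-b²`; the negative `r` leads to `-a²`, the
    -- positive one below to `-c²`. The factor `2 / √(a² - c²)` is the same and cancels in the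
    -- ratio.
    have := integral_one_div_sqrt_eq (g := hPoly a b c) (p := -b ^ 2) (r := b ^ 2 - a ^ 2)
      h.n_pos h.m_pos (by linarith) hK (fun θ => by
        have e1 : (√(a ^ 2 - c ^ 2) * deltaAmp n m θ) ^ 2 =
            (b ^ 2 - c ^ 2) + (a ^ 2 - b ^ 2) * Real.sin θ ^ 2 := by
          rw [mul_pow, hK2, deltaAmp_sq h.n_pos h.m_pos, mul_add, hn', ← mul_assoc, hm']
        have e2 := Real.sin_sq_add_cos_sq θ
        have e3 : hPoly a b c (-b ^ 2 + (b ^ 2 - a ^ 2) * Real.sin θ ^ 2) =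
            ((b ^ 2 - a ^ 2) * Real.sin θ * Real.cos θ * √(a ^ 2 - c ^ 2) *
              deltaAmp n m θ) ^ 2 := by
          rw [mul_assoc _ √(a ^ 2 - c ^ 2), mul_pow _ (√(a ^ 2 - c ^ 2) * _), e1, hPoly, mul_pow,
            Real.cos_sq']
          ring
        rw [e3, abs_of_nonneg (sq_nonneg _)])
    rw [min_eq_right (by linarith), max_eq_left (by linarith),
      show -b ^ 2 + (b ^ 2 - a ^ 2) = -a ^ 2 by ring] at this
    rw [S₂, intervalIntegral.integral_of_le (by linarith),
      MeasureTheory.integral_Ioc_eq_integral_Ioo, this]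
  have hS₁ : S₁ a b c = 2 / √(a ^ 2 - c ^ 2) * quarterPeriod m n := by
    have := integral_one_div_sqrt_eq (g := hPoly a b c) (p := -b ^ 2) (r := b ^ 2 - c ^ 2)
      h.m_pos h.n_pos (by linarith) hK (fun θ => by
        have e1 : (√(a ^ 2 - c ^ 2) * deltaAmp m n θ) ^ 2 =
            (a ^ 2 - b ^ 2) + (b ^ 2 - c ^ 2) * Real.sin θ ^ 2 := by
          rw [mul_pow, hK2, deltaAmp_sq h.m_pos h.n_pos, mul_add, hm', ← mul_assoc, hn']
        have e3 : hPoly a b c (-b ^ 2 + (b ^ 2 - c ^ 2) * Real.sin θ ^ 2) =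
            -((b ^ 2 - c ^ 2) * Real.sin θ * Real.cos θ * √(a ^ 2 - c ^ 2) *
              deltaAmp m n θ) ^ 2 := by
          rw [mul_assoc _ √(a ^ 2 - c ^ 2), mul_pow _ (√(a ^ 2 - c ^ 2) * _), e1, hPoly, mul_pow,
            Real.cos_sq']
          ring
        rw [e3, abs_neg, abs_of_nonneg (sq_nonneg _)])
    rw [min_eq_left (by linarith), max_eq_right (by linarith),
      show -b ^ 2 + (b ^ 2 - c ^ 2) = -c ^ 2 by ring] at this
    rw [S₁, intervalIntegral.integral_of_le (by linarith),
      MeasureTheory.integral_Ioc_eq_integral_Ioo, this]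
  rw [rho, hS₁, hS₂, mul_div_mul_left _ _ (by positivity)]

end ConfocalModuli

end

theorem proposition9 (a b c : ℝ) (hc : 0 < c) (hbc : c < b) (hab : b < a) :
    (Irrational (rho a b c) →
      ∀ (I : Set ℝ) (γ : ℝ → E3), IsHarmonicLine a b c I γ →
        (IsOmegaRecurrent I γ ∨ IsAlphaRecurrent I γ) ∧
        (¬ IsUmbilicSeparatrix a b c I γ → IsOmegaRecurrent I γ ∧ IsAlphaRecurrent I γ) ∧
        ¬ IsClosedLine I γ) ∧
    ((∃ q : ℚ, rho a b c = (q : ℝ)) →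
      ∀ (I : Set ℝ) (γ : ℝ → E3), IsHarmonicLine a b c I γ →
        (IsClosedLine I γ ↔ ¬ IsUmbilicSeparatrix a b c I γ)) := by
  have h := confocalModuli hc hbc hab
  rw [h.rho_eq rfl rfl]
  set m := (a ^ 2 - b ^ 2) / (a ^ 2 - c ^ 2)
  set n := (b ^ 2 - c ^ 2) / (a ^ 2 - c ^ 2)
  constructor
  · intro hirr I γ hγ
    obtain ⟨u₀, v₀, d₁, d₂, t₀, hd₁, hd₂, h0, hI, hEq⟩ := h.exists_eqOn_diagonalLine hγ
    have hparam0 := h.diagonalParam_zero hd₁ u₀ v₀ d₂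
    have hmono := (h.strictMono_diagonalParam hd₁ u₀ v₀ d₂).monotone
    refine ⟨?_, fun hns => ?_, ?_⟩
    -- At most one umbilic parameter exists on the diagonal. If it is on the forward side the
    -- backward half-line is free of umbilic points; otherwise the forward one is.
    · by_cases hex : ∃ s, 0 ≤ s ∧ confocalFactor m n (u₀ + d₁ * s) (v₀ + d₂ * s) = 0
      · obtain ⟨s, hs, hs0⟩ := hex
        refine Or.inr (h.isAlphaRecurrent (t₀ := t₀) hd₁ hd₂ hEq fun t ht => ?_)
        rw [hI, mem_ordConnectedComponent, uIcc_of_ge ht]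
        intro x hx hx0
        have h1 := h.subsingleton_umbilic_times hd₁ hd₂ hirr hs0 hx0
        have h2 : x - t₀ ≤ 0 := sub_nonpos.2 hx.2
        have h3 := hmono h2
        rw [← h1, hparam0] at h3
        -- An umbilic parameter on both sides could only be the starting point, which is not
        -- umbilic.
        have h4 : s = 0 := le_antisymm h3 hs
        rw [h4] at hs0
        exact h0 (by rw [hparam0]; exact hs0)
      · push Not at hex
        refine Or.inl (h.isOmegaRecurrent (t₀ := t₀) hd₁ hd₂ hEq fun t ht => ?_)
        rw [hI, mem_ordConnectedComponent, uIcc_of_le ht]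
        intro x hx
        refine hex _ ?_
        rw [← hparam0]
        exact hmono (sub_nonneg.2 hx.1)
    · have hu := h.eq_univ_of_not_isUmbilicSeparatrix hd₁ hEq h0 hI hns
      exact ⟨h.isOmegaRecurrent (t₀ := t₀) hd₁ hd₂ hEq (hu ▸ subset_univ _),
        h.isAlphaRecurrent (t₀ := t₀) hd₁ hd₂ hEq (hu ▸ subset_univ _)⟩
    · refine h.not_isClosedLine_of_irrational hd₁ hEq hd₂ hirr fun hu t => ?_
      have : t + t₀ ∈ I := hu ▸ mem_univ _
      rw [hI] at this
      simpa using ordConnectedComponent_subset this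
  · rintro ⟨q, hq⟩ I γ hγ
    obtain ⟨u₀, v₀, d₁, d₂, t₀, hd₁, hd₂, h0, hI, hEq⟩ := h.exists_eqOn_diagonalLine hγ
    exact ⟨not_isUmbilicSeparatrix_of_isClosedLine hγ.toIsHarmonicArc, fun hns =>
      h.isClosedLine_of_rational hd₁ hd₂ hEq hq
        (h.eq_univ_of_not_isUmbilicSeparatrix hd₁ hEq h0 hI hns)⟩
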